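/- For $\Lambda\in\{1,-1,0\}$ let $X_\Lambda\subset\mathbb{RP}^3$ be the projective model of 3d de Sitter space ($\Lambda=1$), anti-de Sitter space ($\Lambda=-1$) or Minkowski space ($\Lambda=0$): the set of lines $[x]$, $x\in\mathbb R^4$, with $-x_1^2+x_2^2+x_3^2+x_4^2>0$, with $-x_1^2-x_2^2+x_3^2+x_4^2<0$, or with $x_2\neq 0$, respectively. It carries the Lorentzian metric of constant curvature $\Lambda$ induced by the form $-x_1^2+\Lambda x_2^2+x_3^2+x_4^2$ on the quadric of normalized representatives ($\langle x,x\rangle=1$, $\langle x,x\rangle=-1$, or $x_2=\pm1$, respectively), and volumes are taken with respect to the volume form of this metric. Geodesics and geodesic planes are the intersections of $X_\Lambda$ with projective lines and planes. A geodesic plane is lightlike if it contains a lightlike but no timelike geodesic. A lightlike tetrahedron $\Theta\subset X_\Lambda$ is a geodesic 3-simplex contained in $X_\Lambda$ that is convex (the projection of the convex cone spanned by four vectors of $\mathbb R^4$ representing its vertices) and non-degenerate (not contained in a geodesic plane), whose four faces lie in lightlike planes, and such that every geodesic joining a vertex to an interior point of $\Theta$ is spacelike. Put $s_\Lambda(\theta)=\sin\theta,\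 \sinh\theta,\ \theta$ for $\Lambda=1,-1,0$, respectively, and $\mathrm{Cl}_\Lambda(x)=-\int_0^x\log|2s_\Lambda(\theta/2)|\,d\theta$. **Theorem.** Let $\Theta\subset X_\Lambda$ be a lightlike tetrahedron. Then opposite edges of $\Theta$ have the same arc length, and the three lengths are $\alpha$, $\beta$ and $-\gamma=\alpha+\beta$ for some $\alpha,\beta>0$. The volume of $\Theta$ is finite. For $\Lambda=\pm1$ it is $$\mathrm{vol}(\Theta)=\frac1{2\Lambda}\Big(\mathrm{Cl}_\Lambda(2\alpha)+\mathrm{Cl}_\Lambda(2\beta)+\mathrm{Cl}_\Lambda(2\gamma)\Big)+\frac1\Lambda\Big(\alpha\log|s_\Lambda(\alpha)|+\beta\log|s_\Lambda(\beta)|+\gamma\log|s_\Lambda(\gamma)|\Big),$$ and for $\Lambda=0$ it is $\mathrm{vol}(\Theta)=-\tfrac13\alpha\beta\gamma$. -/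

import Mathlib

open MeasureTheory
open scoped LinearAlgebra.Projectivization

noncomputable section

/-- The ambient vector space `ℝ⁴`. Its coordinates `x₁, x₂, x₃, x₄` are `x 0, x 1, x 2, x 3`. -/
abbrev R4 : Type := Fin 4 → ℝ

/-- The symmetric bilinear form on `ℝ⁴` from which the metric is induced. For the curvature
`Λ = 1, -1, 0` it is the form `⟨·,·⟩` of `ℝ^{1,0,3}`, `ℝ^{2,0,2}`, `ℝ^{1,1,2}`, respectively
(`p` minus signs, `q` zeros and `r` plus signs in `ℝ^{p,q,r}`). -/
def ambientForm (Λ : SignType) (x y : R4) : ℝ :=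
  -(x 0 * y 0) + (Λ : ℝ) * (x 1 * y 1) + x 2 * y 2 + x 3 * y 3

/-- The symmetric bilinear form whose quadratic form cuts out `X_Λ`: it is
`⟨x,y⟩_{1,0,3}` for `Λ = 1`, `-⟨x,y⟩_{2,0,2}` for `Λ = -1` and `x₂ y₂` for `Λ = 0`. -/
def pointForm (Λ : SignType) (x y : R4) : ℝ :=
  x 1 * y 1 + (Λ : ℝ) * (-(x 0 * y 0) + x 2 * y 2 + x 3 * y 3)

/-- The space `X_Λ ⊆ ℝP³`: de Sitter space (`Λ = 1`), anti-de Sitter space (`Λ = -1`) and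
Minkowski space (`Λ = 0`). -/
def spaceX (Λ : SignType) : Set (ℙ ℝ R4) :=
  {p | 0 < pointForm Λ p.rep p.rep}

theorem mk_mem_spaceX (Λ : SignType) (v : R4) (hv : v ≠ 0) :
    Projectivization.mk ℝ v hv ∈ spaceX Λ ↔ 0 < pointForm Λ v v := by
  obtain ⟨c, hc⟩ := Projectivization.exists_smul_eq_mk_rep ℝ v hv
  have h : pointForm Λ (Projectivization.mk ℝ v hv).rep (Projectivization.mk ℝ v hv).rep
      = (c : ℝ) ^ 2 * pointForm Λ v v := by
    rw [← hc]
    simp only [pointForm, Units.smul_def, Pi.smul_apply, smul_eq_mul]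
    ring
  have hc2 : 0 < (c : ℝ) ^ 2 := by
    have := c.ne_zero
    positivity
  simp only [spaceX, Set.mem_ofPred_eq, h]
  exact mul_pos_iff_of_pos_left hc2

/-- The representative of `[v] ∈ X_Λ` on the quadric `pointForm Λ x x = 1`, that is, on
`⟨x,x⟩_{1,0,3} = 1`, on `⟨x,x⟩_{2,0,2} = -1`, or on `x₂ = ± 1`, respectively. -/
def unitLift (Λ : SignType) (v : R4) : R4 :=
  (Real.sqrt (pointForm Λ v v))⁻¹ • v

/-- `w` is tangent to the quadric `pointForm Λ x x = 1` at its point `x`. The metric of `X_Λ` at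
`[x]` is the restriction of `ambientForm Λ` to these vectors. -/
def IsTangentAt (Λ : SignType) (x w : R4) : Prop :=
  pointForm Λ x w = 0

/-! ### Geodesics and geodesic planes -/

/-- The plane `W ⊆ ℝ⁴` projects to a geodesic of `X_Λ`. -/
def IsGeodesic (Λ : SignType) (W : Submodule ℝ R4) : Prop :=
  Module.finrank ℝ W = 2 ∧ ∃ x ∈ W, 0 < pointForm Λ x x

/-- `W` projects to a geodesic all of whose tangent vectors are spacelike. -/
def IsSpacelikeGeodesic (Λ : SignType) (W : Submodule ℝ R4) : Prop :=
  IsGeodesic Λ W ∧ ∀ x ∈ W, pointForm Λ x x = 1 →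
    ∀ w ∈ W, w ≠ 0 → IsTangentAt Λ x w → 0 < ambientForm Λ w w

/-- `W` projects to a geodesic all of whose tangent vectors are lightlike. -/
def IsLightlikeGeodesic (Λ : SignType) (W : Submodule ℝ R4) : Prop :=
  IsGeodesic Λ W ∧ ∀ x ∈ W, pointForm Λ x x = 1 →
    ∀ w ∈ W, w ≠ 0 → IsTangentAt Λ x w → ambientForm Λ w w = 0

/-- `W` projects to a geodesic all of whose tangent vectors are timelike. -/
def IsTimelikeGeodesic (Λ : SignType) (W : Submodule ℝ R4) : Prop :=
  IsGeodesic Λ W ∧ ∀ x ∈ W, pointForm Λ x x = 1 →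
    ∀ w ∈ W, w ≠ 0 → IsTangentAt Λ x w → ambientForm Λ w w < 0

/-- The three-dimensional subspace `U ⊆ ℝ⁴` projects to a lightlike geodesic plane of `X_Λ`:
one that contains a lightlike geodesic, but no timelike geodesic. -/
def IsLightlikePlane (Λ : SignType) (U : Submodule ℝ R4) : Prop :=
  Module.finrank ℝ U = 3 ∧
    (∃ W ≤ U, IsLightlikeGeodesic Λ W) ∧ ∀ W ≤ U, ¬ IsTimelikeGeodesic Λ W

/-! ### Lightlike tetrahedra -/

/-- The projection to `ℝP³` of the convex cone spanned by `v 0, v 1, v 2, v 3`. -/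
def geodesicSimplex (v : Fin 4 → R4) : Set (ℙ ℝ R4) :=
  {p | ∃ a : Fin 4 → ℝ, (∀ i, 0 ≤ a i) ∧
    ∃ h : ∑ i, a i • v i ≠ 0, p = Projectivization.mk ℝ (∑ i, a i • v i) h}

/-- `v 0, v 1, v 2, v 3` represent the vertices of a lightlike tetrahedron
`Θ = geodesicSimplex v` in `X_Λ`. (As spacelike geodesics of de Sitter space are closed, the
vertices `[v i]` alone do not determine `Θ`; the representatives `v i` do.) -/
structure IsLightlikeTetrahedron (Λ : SignType) (v : Fin 4 → R4) : Prop where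
  /-- `Θ` is non-degenerate: it is not contained in a geodesic plane. -/
  nondegenerate : LinearIndependent ℝ v
  /-- `Θ` is contained in `X_Λ`. -/
  subset_space : geodesicSimplex v ⊆ spaceX Λ
  /-- The face opposite to each vertex lies in a lightlike geodesic plane. -/
  lightlike_faces : ∀ i, IsLightlikePlane Λ (Submodule.span ℝ (v '' {i}ᶜ))
  /-- Every geodesic through a vertex and an interior point of `Θ` is spacelike. -/
  internal_spacelike : ∀ (i : Fin 4) (a : Fin 4 → ℝ), (∀ j, 0 < a j) →
    IsSpacelikeGeodesic Λ (Submodule.span ℝ {v i, ∑ j, a j • v j})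

/-- The arc length in `X_Λ` of the geodesic segment
`{[(1 - t) v + t w] | 0 ≤ t ≤ 1}` from `[v]` to `[w]`. -/
def segmentLength (Λ : SignType) (v w : R4) : ℝ :=
  let c : ℝ → R4 := fun t => unitLift Λ ((1 - t) • v + t • w)
  ∫ t in (0 : ℝ)..1, Real.sqrt |ambientForm Λ (deriv c t) (deriv c t)|

/-! ### Volume -/

/-- The affine chart `u ↦ [(u₁, 1, u₂, u₃)]` of `ℝP³`, as a map to `ℝ⁴`. -/
def chartVec (u : Fin 3 → ℝ) : R4 := ![u 0, 1, u 1, u 2]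

theorem chartVec_ne_zero (u : Fin 3 → ℝ) : chartVec u ≠ 0 := by
  intro h
  have := congrFun h 1
  simp [chartVec] at this

/-- The matrix of the metric of `X_Λ` in the affine chart: the pullback of `ambientForm Λ` under
`u ↦ unitLift Λ (u₁, 1, u₂, u₃)`. -/
def metricMatrix (Λ : SignType) (u : Fin 3 → ℝ) : Matrix (Fin 3) (Fin 3) ℝ :=
  Matrix.of fun i j =>
    ambientForm Λ
      (fderiv ℝ (fun u' => unitLift Λ (chartVec u')) u (Pi.single i 1))
      (fderiv ℝ (fun u' => unitLift Λ (chartVec u')) u (Pi.single j 1))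

/-- The volume of `S ⊆ X_Λ` for the volume form of the Lorentzian metric, which is
`√|det g| du₁ du₂ du₃` in the affine chart. The chart misses at most a geodesic plane, which has
volume zero. -/
def volX (Λ : SignType) (S : Set (ℙ ℝ R4)) : ENNReal :=
  ∫⁻ u in {u : Fin 3 → ℝ | Projectivization.mk ℝ (chartVec u) (chartVec_ne_zero u) ∈ S},
    ENNReal.ofReal (Real.sqrt |(metricMatrix Λ u).det|)

/-! ### Generalized sine and Clausen functions -/

/-- The generalized sine `s_Λ`. -/
def genSin : SignType → ℝ → ℝ
  | .pos, θ => Real.sin θ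
  | .neg, θ => Real.sinh θ
  | .zero, θ => θ

/-- The generalized Clausen function `Cl_Λ`. -/
def genClausen (Λ : SignType) (x : ℝ) : ℝ :=
  -∫ θ in (0 : ℝ)..x, Real.log |2 * genSin Λ (θ / 2)|

end

/-! The edge lengths are determined at the vertices. Normalize the vertices and project three of
them to the tangent space at the fourth. Each face through this vertex is lightlike, so the metric
is semidefinite and degenerate on the span of two of the projected vectors
(`IsLightlikePlane.gram`), and their product is plus or minus the product of their norms.
Nondegeneracy of the metric forces the product of the three signs to be -1, and spacelikeness of the
interior directions excludes three minus signs. So exactly one of the three face angles at a vertex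
is straight and the other two are zero (`exists_signs`).

By the law of cosines in a face, a plus sign makes the third side the difference of the other two,
and a minus sign makes it their sum, up to the de Sitter case of perimeter 2π (`genDist_triangle`).
No triangle has only plus signs, so the four minus signs are distributed one to a face. This forces
opposite edges to agree, and the longest length to be the sum of the other two
(`exists_perm_of_triangles`).

For the volume, the density in the affine chart is q⁻², where q is the quadratic form cutting out
the space. Integrating t³ along rays identifies the volume with four times the Lebesgue measure of
the truncated cone q < 1 (`lintegral_chart_eq_volume_cone`). A linear change of variables then
replaces the cone by the positive orthant at the price of |det v|, which is 2 s(α) s(β) s(α+β) by a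
Gram determinant.

The integral is evaluated in geodesic polar coordinates around vertex 0. The opposite face is
parametrized by (s,t) in (0,α) × (0,β) so that the distance to vertex 0 is s + t. The radial
integral gives the area function P(u) = ∫₀ᵘ s_Λ², and all Jacobians combine to the density
2P(s+t)/s_Λ(s+t)² (`lintegral_tetrahedron`). A function of s + t over a rectangle integrates to the
second difference H(α+β) - H(α) - H(β) + H(0) of a double antiderivative. For Λ ≠ 0 this H is, up to
a linear term, -Λ times `edgeVolume`; for Λ = 0 it is cubic. -/

/-! ### Generalized trigonometric functions -/

/-- The derivative of `genSin Λ`. -/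
noncomputable def genCos : SignType → ℝ → ℝ
  | .pos, θ => Real.cos θ
  | .neg, θ => Real.cosh θ
  | .zero, _ => 1

/-- `x` lies in the interval `(0, π)` (for `Λ = 1`) or `(0, ∞)` on which `genSin Λ` is positive. -/
def IsGenAngle (Λ : SignType) (x : ℝ) : Prop :=
  0 < x ∧ (Λ = 1 → x < Real.pi)

theorem IsGenAngle.mono {Λ : SignType} {x y : ℝ} (hy : IsGenAngle Λ y) (hx : 0 < x)
    (hxy : x ≤ y) : IsGenAngle Λ x :=
  ⟨hx, fun h => hxy.trans_lt (hy.2 h)⟩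

theorem IsGenAngle.genSin_pos {Λ : SignType} {x : ℝ} (hx : IsGenAngle Λ x) : 0 < genSin Λ x := by
  rcases Λ with _ | _ | _
  · exact hx.1
  · exact Real.sinh_pos_iff.2 hx.1
  · exact Real.sin_pos_of_pos_of_lt_pi hx.1 (hx.2 rfl)

theorem genSin_zero (Λ : SignType) : genSin Λ 0 = 0 := by
  rcases Λ with _ | _ | _ <;> simp [genSin]

theorem genCos_zero (Λ : SignType) : genCos Λ 0 = 1 := by
  rcases Λ with _ | _ | _ <;> simp [genCos]

theorem genSin_neg (Λ : SignType) (x : ℝ) : genSin Λ (-x) = -genSin Λ x := by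
  rcases Λ with _ | _ | _ <;> simp [genSin]

theorem genCos_neg (Λ : SignType) (x : ℝ) : genCos Λ (-x) = genCos Λ x := by
  rcases Λ with _ | _ | _ <;> simp [genCos]

theorem genSin_add (Λ : SignType) (x y : ℝ) :
    genSin Λ (x + y) = genSin Λ x * genCos Λ y + genCos Λ x * genSin Λ y := by
  rcases Λ with _ | _ | _ <;> simp [genSin, genCos, Real.sinh_add, Real.sin_add]

theorem genCos_add (Λ : SignType) (x y : ℝ) :
    genCos Λ (x + y) = genCos Λ x * genCos Λ y - (Λ : ℝ) * (genSin Λ x * genSin Λ y) := by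
  rcases Λ with _ | _ | _ <;> simp [genSin, genCos, Real.cosh_add, Real.cos_add]

theorem genSin_sub (Λ : SignType) (x y : ℝ) :
    genSin Λ (x - y) = genSin Λ x * genCos Λ y - genCos Λ x * genSin Λ y := by
  rw [sub_eq_add_neg, genSin_add, genSin_neg, genCos_neg]; ring

theorem genCos_sub (Λ : SignType) (x y : ℝ) :
    genCos Λ (x - y) = genCos Λ x * genCos Λ y + (Λ : ℝ) * (genSin Λ x * genSin Λ y) := by
  rw [sub_eq_add_neg, genCos_add, genSin_neg, genCos_neg]; ring

theorem genCos_sq_add (Λ : SignType) (x : ℝ) :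
    genCos Λ x ^ 2 + (Λ : ℝ) * genSin Λ x ^ 2 = 1 := by
  rcases Λ with _ | _ | _ <;> simp [genSin, genCos, Real.cosh_sq]

theorem hasDerivAt_genSin (Λ : SignType) (x : ℝ) : HasDerivAt (genSin Λ) (genCos Λ x) x := by
  rcases Λ with _ | _ | _
  · exact hasDerivAt_id x
  · exact Real.hasDerivAt_sinh x
  · exact Real.hasDerivAt_sin x

theorem hasDerivAt_genCos (Λ : SignType) (x : ℝ) :
    HasDerivAt (genCos Λ) (-((Λ : ℝ) * genSin Λ x)) x := by
  rcases Λ with _ | _ | _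
  · exact (hasDerivAt_const x (1 : ℝ)).congr_deriv (by simp)
  · exact (Real.hasDerivAt_cosh x).congr_deriv (by simp [genSin])
  · exact (Real.hasDerivAt_cos x).congr_deriv (by simp [genSin])

theorem continuous_genSin (Λ : SignType) : Continuous (genSin Λ) :=
  continuous_iff_continuousAt.2 fun x => (hasDerivAt_genSin Λ x).continuousAt

theorem continuous_genCos (Λ : SignType) : Continuous (genCos Λ) :=
  continuous_iff_continuousAt.2 fun x => (hasDerivAt_genCos Λ x).continuousAt

theorem IsGenAngle.hasDerivAt_cot {Λ : SignType} {x : ℝ} (hx : IsGenAngle Λ x) :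
    HasDerivAt (fun x => genCos Λ x / genSin Λ x) (-(1 / genSin Λ x ^ 2)) x := by
  have hS := hx.genSin_pos.ne'
  refine ((hasDerivAt_genCos Λ x).div (hasDerivAt_genSin Λ x) hS).congr_deriv ?_
  field_simp
  linear_combination -genCos_sq_add Λ x

theorem tendsto_cot_nhdsGT_zero (Λ : SignType) :
    Filter.Tendsto (fun x => genCos Λ x / genSin Λ x) (nhdsWithin 0 (Set.Ioi 0)) Filter.atTop := by
  have h1 : Filter.Tendsto (genCos Λ) (nhdsWithin 0 (Set.Ioi 0)) (nhds 1) := by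
    rw [← genCos_zero Λ]
    exact (continuous_genCos Λ).continuousAt.tendsto.mono_left nhdsWithin_le_nhds
  have h2 : Filter.Tendsto (genSin Λ) (nhdsWithin 0 (Set.Ioi 0)) (nhdsWithin 0 (Set.Ioi 0)) := by
    refine tendsto_nhdsWithin_iff.2 ⟨?_, ?_⟩
    · have h := (continuous_genSin Λ).tendsto 0
      rw [genSin_zero] at h
      exact h.mono_left nhdsWithin_le_nhds
    · filter_upwards [Ioo_mem_nhdsGT Real.pi_pos] with x hx
      exact IsGenAngle.genSin_pos ⟨hx.1, fun _ => hx.2⟩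
  exact (h1.pos_mul_atTop one_pos h2.inv_tendsto_nhdsGT_zero).congr fun x => (div_eq_mul_inv _ _).symm

/-! ### Changes of variables on half-lines -/

theorem lintegral_Ioi_eq_of_strictMonoOn {g g' : ℝ → ℝ} {s : Set ℝ} (hs : MeasurableSet s)
    (hg : ∀ x ∈ s, HasDerivAt g (g' x) x) (hinj : Set.InjOn g s) (himg : g '' s = Set.Ioi 0)
    (f : ℝ → ENNReal) :
    ∫⁻ y in Set.Ioi 0, f y = ∫⁻ x in s, ENNReal.ofReal |g' x| * f (g x) := by
  rw [← himg]
  exact lintegral_image_eq_lintegral_abs_deriv_mul hs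
    (fun x hx => (hg x hx).hasDerivWithinAt) hinj f

/-- The substitution `y = cot x - cot a`. -/
theorem IsGenAngle.lintegral_cot {Λ : SignType} {a : ℝ} (ha : IsGenAngle Λ a) (f : ℝ → ENNReal) :
    ∫⁻ y in Set.Ioi 0, f y = ∫⁻ x in Set.Ioo 0 a, ENNReal.ofReal (1 / genSin Λ x ^ 2) *
      f (genCos Λ x / genSin Λ x - genCos Λ a / genSin Λ a) := by
  set g : ℝ → ℝ := fun x => genCos Λ x / genSin Λ x with hgdef
  have hd : ∀ x ∈ Set.Ioc 0 a, HasDerivAt g (-(1 / genSin Λ x ^ 2)) x := fun x hx =>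
    (ha.mono hx.1 hx.2).hasDerivAt_cot
  have hanti : StrictAntiOn g (Set.Ioc 0 a) := by
    refine strictAntiOn_of_deriv_neg (convex_Ioc 0 a)
      (fun x hx => (hd x hx).continuousAt.continuousWithinAt) fun x hx => ?_
    rw [interior_Ioc] at hx
    rw [(hd x ⟨hx.1, hx.2.le⟩).deriv]
    have := (ha.mono hx.1 hx.2.le).genSin_pos
    exact neg_lt_zero.2 (by positivity)
  rw [lintegral_Ioi_eq_of_strictMonoOn (g := fun x => g x - g a) (g' := fun x => -(1 / genSin Λ x ^ 2))
    measurableSet_Ioo (fun x hx => (hd x ⟨hx.1, hx.2.le⟩).sub_const _)]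
  · refine setLIntegral_congr_fun measurableSet_Ioo fun x _ => ?_
    simp only [abs_neg]
    rw [abs_of_nonneg (by positivity)]
  · intro x hx y hy hxy
    exact hanti.injOn ⟨hx.1, hx.2.le⟩ ⟨hy.1, hy.2.le⟩ (sub_left_injective hxy)
  · ext y
    constructor
    · rintro ⟨x, hx, rfl⟩
      exact sub_pos.2 (hanti ⟨hx.1, hx.2.le⟩ ⟨ha.1, le_rfl⟩ hx.2)
    · intro hy
      have h1 := (tendsto_cot_nhdsGT_zero Λ).eventually_gt_atTop (y + g a)
      obtain ⟨x₀, hx₀, hx₀'⟩ := (h1.and (Ioo_mem_nhdsGT ha.1)).exists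
      have hy : 0 < y := hy
      have hc : ContinuousOn g (Set.Icc x₀ a) := fun x hx =>
        (hd x ⟨hx₀'.1.trans_le hx.1, hx.2⟩).continuousAt.continuousWithinAt
      obtain ⟨x, hx, hxy⟩ := intermediate_value_Icc' hx₀'.2.le hc
        (show y + g a ∈ Set.Icc (g a) (g x₀) from ⟨by linarith, hx₀.le⟩)
      refine ⟨x, ⟨hx₀'.1.trans_le hx.1, lt_of_le_of_ne hx.2 ?_⟩, by simp [hxy]⟩
      rintro rfl
      linarith

/-- The substitution `y = c x`. -/
theorem lintegral_Ioi_mul_left {c : ℝ} (hc : 0 < c) (f : ℝ → ENNReal) :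
    ∫⁻ y in Set.Ioi 0, f y = ∫⁻ x in Set.Ioi 0, ENNReal.ofReal c * f (c * x) := by
  rw [lintegral_Ioi_eq_of_strictMonoOn (g := fun x => c * x) (g' := fun _ => c) measurableSet_Ioi
    (fun x _ => by simpa using (hasDerivAt_id x).const_mul c), abs_of_pos hc]
  · exact fun x _ y _ h => mul_left_cancel₀ hc.ne' h
  · ext y
    refine ⟨?_, fun hy => ⟨y / c, div_pos hy hc, by simp; field_simp⟩⟩
    rintro ⟨x, hx, rfl⟩
    exact mul_pos hc hx

/-- The substitution `y = c / x`. -/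
theorem lintegral_Ioi_const_div {c : ℝ} (hc : 0 < c) (f : ℝ → ENNReal) :
    ∫⁻ y in Set.Ioi 0, f y = ∫⁻ x in Set.Ioi 0, ENNReal.ofReal (c / x ^ 2) * f (c / x) := by
  rw [lintegral_Ioi_eq_of_strictMonoOn (g := fun x => c / x) (g' := fun x => -(c / x ^ 2))
    measurableSet_Ioi]
  · refine setLIntegral_congr_fun measurableSet_Ioi fun x _ => ?_
    simp only [abs_neg]
    rw [abs_of_nonneg (by positivity)]
  · intro x hx
    have hx : x ≠ 0 := (Set.mem_Ioi.1 hx).ne'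
    refine ((hasDerivAt_inv hx).const_mul c).congr_deriv ?_
    field_simp
  · intro x hx y hy h
    have hx : x ≠ 0 := (Set.mem_Ioi.1 hx).ne'
    have hy : y ≠ 0 := (Set.mem_Ioi.1 hy).ne'
    simp only at h
    field_simp at h
    exact h.symm
  · ext y
    refine ⟨?_, fun hy => ⟨c / y, div_pos hc hy, ?_⟩⟩
    · rintro ⟨x, hx, rfl⟩
      exact div_pos hc hx
    · have hy : y ≠ 0 := (Set.mem_Ioi.1 hy).ne'
      simp only
      field_simp

/-- The substitution `y = x (k / (x + m) + m)`. -/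
theorem lintegral_Ioi_mobius {k m : ℝ} (hk : 0 < k) (hm : 0 < m) (f : ℝ → ENNReal) :
    ∫⁻ y in Set.Ioi 0, f y = ∫⁻ x in Set.Ioi 0,
      ENNReal.ofReal (k * m / (x + m) ^ 2 + m) * f (x * (k / (x + m) + m)) := by
  have hd : ∀ x ∈ Set.Ici (0 : ℝ),
      HasDerivAt (fun x => x * (k / (x + m) + m)) (k * m / (x + m) ^ 2 + m) x := by
    intro x hx
    have hxm : x + m ≠ 0 := by have : 0 ≤ x := hx; positivity
    have h1 : HasDerivAt (fun x => x + m) 1 x := (hasDerivAt_id x).add_const m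
    have h2 := (hasDerivAt_id x).mul (((hasDerivAt_const x k).div h1 hxm).add_const m)
    refine h2.congr_deriv ?_
    simp only [id, Pi.div_apply]
    field_simp
    ring
  have hc : ContinuousOn (fun x => x * (k / (x + m) + m)) (Set.Ici 0) := fun x hx =>
    (hd x hx).continuousAt.continuousWithinAt
  have hmono : StrictMonoOn (fun x => x * (k / (x + m) + m)) (Set.Ici 0) := by
    refine strictMonoOn_of_deriv_pos (convex_Ici 0) hc fun x hx => ?_
    rw [interior_Ici] at hx
    rw [(hd x (Set.mem_Ioi.1 hx).le).deriv]
    positivity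
  rw [lintegral_Ioi_eq_of_strictMonoOn (g := fun x => x * (k / (x + m) + m))
    (g' := fun x => k * m / (x + m) ^ 2 + m) measurableSet_Ioi
    (fun x hx => hd x (Set.mem_Ioi.1 hx).le) (hmono.injOn.mono Set.Ioi_subset_Ici_self)]
  · refine setLIntegral_congr_fun measurableSet_Ioi fun x (hx : 0 < x) => ?_
    rw [abs_of_nonneg (by positivity)]
  · ext y
    constructor
    · rintro ⟨x, hx, rfl⟩
      have hx : 0 < x := hx
      simp only [Set.mem_Ioi]
      positivity
    · intro hy
      have hy : 0 < y := hy
      -- The factor multiplying x is at least m, so the value at y / m already reaches y.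
      have h0 : 0 < y / m := by positivity
      obtain ⟨x, hx, hxy⟩ := intermediate_value_Icc h0.le (hc.mono Set.Icc_subset_Ici_self)
        (show y ∈ Set.Icc _ _ from ⟨by simpa using hy.le, by
          have h1 : y / m * m = y := by field_simp
          have h2 : 0 ≤ y / m * (k / (y / m + m)) := by positivity
          linarith [mul_add (y / m) (k / (y / m + m)) m]⟩)
      refine ⟨x, lt_of_le_of_ne hx.1 ?_, hxy⟩
      rintro rfl
      simp at hxy
      linarith

/-- The fundamental theorem of calculus for a nonnegative function. -/
theorem lintegral_Ioo_ofReal_deriv {a b : ℝ} (hab : a ≤ b) {F f : ℝ → ℝ}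
    (hF : ContinuousOn F (Set.Icc a b)) (hd : ∀ x ∈ Set.Ioo a b, HasDerivAt F (f x) x)
    (hf : ∀ x ∈ Set.Ioo a b, 0 ≤ f x) :
    ∫⁻ x in Set.Ioo a b, ENNReal.ofReal (f x) = ENNReal.ofReal (F b - F a) := by
  have hint : IntegrableOn f (Set.Ioc a b) :=
    intervalIntegral.integrableOn_deriv_of_nonneg hF hd hf
  rw [← intervalIntegral.integral_eq_sub_of_hasDerivAt_of_le hab hF hd
    ((intervalIntegrable_iff_integrableOn_Ioc_of_le hab).2 hint),
    intervalIntegral.integral_of_le hab, integral_Ioc_eq_integral_Ioo,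
    ofReal_integral_eq_lintegral_ofReal (hint.mono_set Set.Ioo_subset_Ioc_self)]
  exact (ae_restrict_iff' measurableSet_Ioo).2 (Filter.Eventually.of_forall hf)

/-! ### The two bilinear forms -/

theorem pointForm_comm (Λ : SignType) (x y : R4) : pointForm Λ x y = pointForm Λ y x := by
  simp only [pointForm]; ring

theorem ambientForm_comm (Λ : SignType) (x y : R4) : ambientForm Λ x y = ambientForm Λ y x := by
  simp only [ambientForm]; ring

theorem pointForm_add_right (Λ : SignType) (x y z : R4) :
    pointForm Λ x (y + z) = pointForm Λ x y + pointForm Λ x z := by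
  simp only [pointForm, Pi.add_apply]; ring

theorem pointForm_smul_right (Λ : SignType) (c : ℝ) (x y : R4) :
    pointForm Λ x (c • y) = c * pointForm Λ x y := by
  simp only [pointForm, Pi.smul_apply, smul_eq_mul]; ring

theorem pointForm_smul_smul (Λ : SignType) (c : ℝ) (x : R4) :
    pointForm Λ (c • x) (c • x) = c ^ 2 * pointForm Λ x x := by
  simp only [pointForm, Pi.smul_apply, smul_eq_mul]; ring

theorem ambientForm_add_right (Λ : SignType) (x y z : R4) :
    ambientForm Λ x (y + z) = ambientForm Λ x y + ambientForm Λ x z := by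
  simp only [ambientForm, Pi.add_apply]; ring

theorem ambientForm_smul_right (Λ : SignType) (c : ℝ) (x y : R4) :
    ambientForm Λ x (c • y) = c * ambientForm Λ x y := by
  simp only [ambientForm, Pi.smul_apply, smul_eq_mul]; ring

theorem pointForm_combination (Λ : SignType) (a b c d : ℝ) (v w : R4) :
    pointForm Λ (a • v + b • w) (c • v + d • w) = a * c * pointForm Λ v v +
      (a * d + b * c) * pointForm Λ v w + b * d * pointForm Λ w w := by
  simp only [pointForm, Pi.add_apply, Pi.smul_apply, smul_eq_mul]; ring

theorem ambientForm_combination (Λ : SignType) (a b c d : ℝ) (v w : R4) :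
    ambientForm Λ (a • v + b • w) (c • v + d • w) = a * c * ambientForm Λ v v +
      (a * d + b * c) * ambientForm Λ v w + b * d * ambientForm Λ w w := by
  simp only [ambientForm, Pi.add_apply, Pi.smul_apply, smul_eq_mul]; ring

theorem sq_cast_of_ne_zero {Λ : SignType} (h : Λ ≠ 0) : (Λ : ℝ) ^ 2 = 1 := by
  rcases SignType.trichotomy Λ with rfl | rfl | rfl <;> simp at h ⊢

theorem ambientForm_eq_mul_pointForm {Λ : SignType} (h : Λ ≠ 0) (x y : R4) :
    ambientForm Λ x y = Λ * pointForm Λ x y := by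
  simp only [ambientForm, pointForm]
  linear_combination (x 0 * y 0 - x 2 * y 2 - x 3 * y 3) * sq_cast_of_ne_zero h

theorem pointForm_zero_eq (x y : R4) : pointForm 0 x y = x 1 * y 1 := by
  simp [pointForm]

/-- The metric on a geodesic through `v` in direction `w`. -/
theorem ambientForm_of_tangent {Λ : SignType} {v w : R4} (hv : pointForm Λ v v = 1)
    (hw : pointForm Λ v w = 0) {a b c d : ℝ}
    (hx : pointForm Λ (a • v + b • w) (a • v + b • w) = 1)
    (hy : pointForm Λ (a • v + b • w) (c • v + d • w) = 0) :
    ambientForm Λ (c • v + d • w) (c • v + d • w) = (a * d - b * c) ^ 2 * ambientForm Λ w w := by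
  by_cases h : Λ = 0
  · subst h
    simp only [pointForm_zero_eq] at hv hw
    have hv1 : v 1 ≠ 0 := fun h0 => by simp [h0] at hv
    have hw1 : w 1 = 0 := (mul_eq_zero.1 hw).resolve_left hv1
    rw [pointForm_combination] at hx hy
    simp only [pointForm_zero_eq, hw1, hv] at hx hy
    have ha : a ≠ 0 := fun h0 => by simp [h0] at hx
    have hc : c = 0 := by simpa [ha] using hy
    rw [ambientForm_combination, hc]
    linear_combination (-d ^ 2 * ambientForm 0 w w) * hx
  -- For Λ ≠ 0 this compares Gram determinants: both pairs consist of a unit vector and a vector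
  -- orthogonal to it, and the change of basis has determinant ad - bc.
  · rw [pointForm_combination, hv, hw] at hx hy
    rw [ambientForm_combination]
    simp only [ambientForm_eq_mul_pointForm h]
    rw [hv, hw]
    linear_combination (-(Λ : ℝ) * (c ^ 2 + pointForm Λ w w * d ^ 2)) * hx
      + Λ * (a * c + pointForm Λ w w * b * d) * hy

theorem linearIndependent_pair_of_tangent {Λ : SignType} {v w : R4} (hv : pointForm Λ v v = 1)
    (hw : pointForm Λ v w = 0) (hw0 : w ≠ 0) : LinearIndependent ℝ ![v, w] := by
  rw [LinearIndependent.pair_iff]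
  intro a b hab
  have h := pointForm_add_right Λ v (a • v) (b • w)
  rw [hab, pointForm_smul_right, pointForm_smul_right, hv, hw] at h
  have ha : a = 0 := by simpa [pointForm] using h.symm
  refine ⟨ha, ?_⟩
  simpa [ha, hw0] using hab

/-- By `ambientForm_of_tangent` the metric on any nonzero tangent vector of the geodesic is a
positive multiple of its value at `w`, so one timelike direction suffices. Hence a lightlike plane
carries no negative tangent vector. -/
theorem isTimelikeGeodesic_span_pair {Λ : SignType} {v w : R4} (hv : pointForm Λ v v = 1)
    (hw : pointForm Λ v w = 0) (hneg : ambientForm Λ w w < 0) :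
    IsTimelikeGeodesic Λ (Submodule.span ℝ {v, w}) := by
  have hw0 : w ≠ 0 := by
    rintro rfl
    simp [ambientForm] at hneg
  have hli := linearIndependent_pair_of_tangent hv hw hw0
  refine ⟨⟨?_, v, Submodule.subset_span (by simp), by simp [hv]⟩, ?_⟩
  · have := finrank_span_eq_card hli
    rwa [Matrix.range_cons, Matrix.range_cons, Matrix.range_empty, Set.union_empty,
      Fintype.card_fin] at this
  · intro x hx hxx y hy hy0 hxy
    obtain ⟨a, b, rfl⟩ := Submodule.mem_span_pair.1 hx
    obtain ⟨c, d, rfl⟩ := Submodule.mem_span_pair.1 hy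
    have hxy : pointForm Λ (a • v + b • w) (c • v + d • w) = 0 := hxy
    rw [ambientForm_of_tangent hv hw hxx hxy]
    refine mul_neg_of_pos_of_neg (lt_of_le_of_ne (sq_nonneg _) fun h0 => hy0 ?_) hneg
    have h0 : a * d - b * c = 0 := by simpa using h0.symm
    rw [pointForm_combination, hv, hw] at hxx hxy
    have hc : c = 0 := by linear_combination -c * hxx + a * hxy - b * pointForm Λ w w * h0
    have hd : d = 0 := by linear_combination -d * hxx + a * h0 + b * hxy
    simp [hc, hd]

theorem IsLightlikeGeodesic.exists_null {Λ : SignType} {W : Submodule ℝ R4}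
    (hW : IsLightlikeGeodesic Λ W) : ∃ x ∈ W, ∃ w ∈ W, pointForm Λ x x = 1 ∧ w ≠ 0 ∧
      pointForm Λ x w = 0 ∧ ambientForm Λ w w = 0 := by
  obtain ⟨⟨hfin, x, hx, hpos⟩, hnull⟩ := hW
  set s := (Real.sqrt (pointForm Λ x x))⁻¹
  have hs : s ^ 2 * pointForm Λ x x = 1 := by
    rw [inv_pow, Real.sq_sqrt hpos.le, inv_mul_cancel₀ hpos.ne']
  have h1 : pointForm Λ (s • x) (s • x) = 1 := by rw [pointForm_smul_smul, hs]
  have hnot : ¬ W ≤ Submodule.span ℝ {s • x} := fun hle => by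
    have h2 := (Submodule.finrank_mono hle).trans (finrank_span_le_card {s • x})
    simp [hfin] at h2
  obtain ⟨y, hy, hy'⟩ := SetLike.not_le_iff_exists.1 hnot
  have hsx : s • x ∈ W := W.smul_mem _ hx
  refine ⟨s • x, hsx, y + (-pointForm Λ (s • x) y) • (s • x),
    W.add_mem hy (W.smul_mem _ hsx), h1, ?_, ?_, ?_⟩
  · intro h0
    refine hy' (Submodule.mem_span_singleton.2 ⟨pointForm Λ (s • x) y, ?_⟩)
    rw [neg_smul, ← sub_eq_add_neg, sub_eq_zero] at h0
    exact h0.symm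
  · rw [pointForm_add_right, pointForm_smul_right (y := s • x), h1]; ring
  · refine hnull _ hsx h1 _ (W.add_mem hy (W.smul_mem _ hsx)) ?_ ?_
    · intro h0
      refine hy' (Submodule.mem_span_singleton.2 ⟨pointForm Λ (s • x) y, ?_⟩)
      rw [neg_smul, ← sub_eq_add_neg, sub_eq_zero] at h0
      exact h0.symm
    · change pointForm Λ (s • x) _ = 0
      rw [pointForm_add_right, pointForm_smul_right (y := s • x), h1]; ring

set_option maxHeartbeats 400000 in
/-- A lightlike plane through `v` is degenerate and semidefinite. -/
theorem IsLightlikePlane.gram {Λ : SignType} {U : Submodule ℝ R4} (hU : IsLightlikePlane Λ U)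
    {v w₁ w₂ : R4} (hv : pointForm Λ v v = 1) (hw₁ : pointForm Λ v w₁ = 0)
    (hw₂ : pointForm Λ v w₂ = 0) (hvU : v ∈ U) (hw₁U : w₁ ∈ U) (hw₂U : w₂ ∈ U)
    (hspan : ∀ x ∈ U, ∃ a b c : ℝ, x = a • v + (b • w₁ + c • w₂)) :
    0 ≤ ambientForm Λ w₁ w₁ ∧
      ambientForm Λ w₁ w₁ * ambientForm Λ w₂ w₂ = ambientForm Λ w₁ w₂ ^ 2 := by
  set p := ambientForm Λ w₁ w₁ with hp
  set r := ambientForm Λ w₂ w₂ with hr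
  set m := ambientForm Λ w₁ w₂ with hm
  have hexp : ∀ a b c d : ℝ, ambientForm Λ (a • w₁ + b • w₂) (c • w₁ + d • w₂)
      = a * c * p + (a * d + b * c) * m + b * d * r := fun a b c d =>
    ambientForm_combination Λ a b c d w₁ w₂
  have htan : ∀ a b : ℝ, pointForm Λ v (a • w₁ + b • w₂) = 0 := fun a b => by
    rw [pointForm_add_right, pointForm_smul_right, pointForm_smul_right, hw₁, hw₂]; ring
  have hnn : ∀ a b : ℝ, 0 ≤ a * a * p + (a * b + b * a) * m + b * b * r := by
    intro a b
    rw [← hexp]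
    by_contra! hlt
    refine hU.2.2 _ ?_ (isTimelikeGeodesic_span_pair hv (htan a b) hlt)
    rw [Submodule.span_le]
    rintro x (rfl | rfl)
    · exact hvU
    · exact U.add_mem (U.smul_mem _ hw₁U) (U.smul_mem _ hw₂U)
  have hp0 : 0 ≤ p := by simpa using hnn 1 0
  have hr0 : 0 ≤ r := by simpa using hnn 0 1
  refine ⟨hp0, ?_⟩
  -- The vectors (r, -m) and (-m, p) take the values r(pr - m²) and p(pr - m²), so a negative
  -- discriminant forces p = r = 0, and then (1, ±1) force m = 0.
  have hΔ : 0 ≤ p * r - m ^ 2 := by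
    have h1 := hnn r (-m)
    have h2 := hnn (-m) p
    by_contra! hlt
    have hr' : r = 0 := by
      refine le_antisymm ?_ hr0
      by_contra! hr'
      nlinarith
    have hp' : p = 0 := by
      refine le_antisymm ?_ hp0
      by_contra! hp'
      nlinarith
    have h3 := hnn 1 1
    have h4 := hnn 1 (-1)
    have hm0 : m = 0 := by linarith
    simp [hr', hp', hm0] at hlt
  rcases hΔ.eq_or_lt with h | hlt
  · linarith
  -- Now the metric is positive definite on the tangent plane at `v`. The lightlike geodesic need
  -- not pass through `v`, so its null vector is written as a v + Y; the aim is a = 0 and Y null,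
  -- whence Y = 0.
  exfalso
  obtain ⟨W, hWU, hW⟩ := hU.2.1
  obtain ⟨x, hx, w, hw, hxx, hw0, hxw, hww⟩ := hW.exists_null
  obtain ⟨b, x₁, x₂, rfl⟩ := hspan x (hWU hx)
  obtain ⟨a, y₁, y₂, rfl⟩ := hspan w (hWU hw)
  have hp1 : 0 < p := lt_of_le_of_ne hp0 fun h0 => by
    rw [← h0] at hlt
    nlinarith [sq_nonneg m]
  have hdef : y₁ * y₁ * p + (y₁ * y₂ + y₂ * y₁) * m + y₂ * y₂ * r = 0 → y₁ = 0 ∧ y₂ = 0 := by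
    intro h0
    have h1 : (p * y₁ + m * y₂) ^ 2 + (p * r - m ^ 2) * y₂ ^ 2 = 0 := by
      linear_combination p * h0
    have h2 : y₂ ^ 2 = 0 := by
      by_contra hne
      have : 0 < y₂ ^ 2 := lt_of_le_of_ne (sq_nonneg _) (Ne.symm hne)
      nlinarith [sq_nonneg (p * y₁ + m * y₂), mul_pos hlt this]
    have h2' : y₂ = 0 := by simpa using h2
    subst h2'
    have : y₁ ^ 2 = 0 := by
      have : p ^ 2 * y₁ ^ 2 = 0 := by linear_combination h1
      simpa [hp1.ne'] using this
    exact ⟨by simpa using this, rfl⟩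
  have key : a = 0 ∧ y₁ * y₁ * p + (y₁ * y₂ + y₂ * y₁) * m + y₂ * y₂ * r = 0 := by
    have hA := hnn y₁ y₂
    have hX := hnn x₁ x₂
    have hCS : (x₁ * x₁ * p + (x₁ * x₂ + x₂ * x₁) * m + x₂ * x₂ * r) *
        (y₁ * y₁ * p + (y₁ * y₂ + y₂ * y₁) * m + y₂ * y₂ * r) -
        (x₁ * y₁ * p + (x₁ * y₂ + x₂ * y₁) * m + x₂ * y₂ * r) ^ 2 =
        (p * r - m ^ 2) * (x₁ * y₂ - x₂ * y₁) ^ 2 := by ring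
    have hCS' := mul_nonneg hlt.le (sq_nonneg (x₁ * y₂ - x₂ * y₁))
    rw [← hCS] at hCS'
    rw [← hexp] at hA hX
    simp only [← hexp] at hCS'
    rw [← hexp]
    set X := x₁ • w₁ + x₂ • w₂
    set Y := y₁ • w₁ + y₂ • w₂
    have hX0 : pointForm Λ v X = 0 := htan _ _
    have hY0 : pointForm Λ v Y = 0 := htan _ _
    have e1 : pointForm Λ (b • v + X) (b • v + X) = b ^ 2 + pointForm Λ X X := by
      have := pointForm_combination Λ b 1 b 1 v X
      rw [one_smul] at this
      rw [this, hv, hX0]; ring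
    have e2 : pointForm Λ (b • v + X) (a • v + Y) = a * b + pointForm Λ X Y := by
      rw [pointForm_add_right, pointForm_smul_right, pointForm_comm, pointForm_add_right,
        pointForm_smul_right, hv, hX0, pointForm_comm Λ _ Y, pointForm_add_right,
        pointForm_smul_right, pointForm_comm Λ Y v, hY0, pointForm_comm Λ Y X]; ring
    have e3 := ambientForm_combination Λ a 1 a 1 v Y
    rw [one_smul, hww] at e3
    rw [e1] at hxx
    rw [e2] at hxw
    rcases SignType.trichotomy Λ with rfl | rfl | rfl
    · simp only [ambientForm_eq_mul_pointForm (show (-1 : SignType) ≠ 0 by decide),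
        SignType.coe_neg_one, hv, hY0] at e3 hA hX hCS' ⊢
      have hb : 1 ≤ b ^ 2 := by linarith
      have hYa : pointForm (-1) Y Y = -a ^ 2 := by linear_combination e3
      have hXb : pointForm (-1) X X = 1 - b ^ 2 := by linarith
      have hXY : pointForm (-1) X Y = -(a * b) := by linarith
      -- In the anti-de Sitter case Cauchy–Schwarz for X and Y reads (b² - 1)a² ≥ (ab)², which
      -- leaves only a = 0.
      rw [hYa, hXb, hXY] at hCS'
      have ha : a ^ 2 = 0 := le_antisymm (by nlinarith) (sq_nonneg a)
      refine ⟨by simpa using ha, ?_⟩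
      rw [hYa, ha]; simp
    · have hv1 : v 1 ≠ 0 := by
        intro h0
        simp [pointForm_zero_eq, h0] at hv
      rw [pointForm_zero_eq] at hX0 hY0
      have hX1 : X 1 = 0 := (mul_eq_zero.1 hX0).resolve_left hv1
      rw [pointForm_zero_eq, hX1] at hxx hxw
      have hb : b ≠ 0 := by
        rintro rfl
        simp at hxx
      have ha : a = 0 := by simpa [hb] using hxw
      refine ⟨ha, ?_⟩
      rw [ha] at e3
      linarith
    · simp only [ambientForm_eq_mul_pointForm (show (1 : SignType) ≠ 0 by decide),
        SignType.coe_one, hv, hY0] at e3 hA ⊢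
      have e4 : a ^ 2 + pointForm 1 Y Y = 0 := by linear_combination -e3
      have ha : a ^ 2 = 0 := le_antisymm (by linarith) (sq_nonneg a)
      exact ⟨by simpa using ha, by linarith⟩
  obtain ⟨h1, h2⟩ := hdef key.2
  exact hw0 (by simp [key.1, h1, h2])

/-! ### Tangential components and sign patterns -/

/-- The component of `x` that is tangent at `v`. -/
noncomputable def tangentPart (Λ : SignType) (v x : R4) : R4 :=
  x - pointForm Λ v x • v

theorem pointForm_tangentPart {Λ : SignType} {v : R4} (hv : pointForm Λ v v = 1) (x : R4) :
    pointForm Λ v (tangentPart Λ v x) = 0 := by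
  rw [tangentPart, sub_eq_add_neg, ← neg_smul, pointForm_add_right, pointForm_smul_right, hv]
  ring

/-- The metric is nondegenerate. -/
theorem eq_zero_of_forall_tangent {Λ : SignType} {v z : R4} (hv : pointForm Λ v v = 1)
    (hz : pointForm Λ v z = 0) (h : ∀ y, pointForm Λ v y = 0 → ambientForm Λ z y = 0) :
    z = 0 := by
  by_cases h0 : Λ = 0
  · subst h0
    simp only [pointForm_zero_eq] at hv hz h
    have hv1 : v 1 ≠ 0 := fun h0 => by simp [h0] at hv
    have hz1 : z 1 = 0 := (mul_eq_zero.1 hz).resolve_left hv1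
    have e0 := h ![1, 0, 0, 0] (by simp)
    have e2 := h ![0, 0, 1, 0] (by simp)
    have e3 := h ![0, 0, 0, 1] (by simp)
    simp [ambientForm] at e0 e2 e3
    ext i
    fin_cases i <;> simpa
  · have hΛ : (Λ : ℝ) ≠ 0 := fun h1 => by simpa [h1] using sq_cast_of_ne_zero h0
    have hall : ∀ y, pointForm Λ z y = 0 := by
      intro y
      have h1 := h _ (pointForm_tangentPart hv y)
      rw [ambientForm_eq_mul_pointForm h0, mul_eq_zero, or_iff_right hΛ, tangentPart,
        sub_eq_add_neg, ← neg_smul, pointForm_add_right, pointForm_smul_right,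
        pointForm_comm Λ z v, hz] at h1
      linarith
    have e0 := hall ![1, 0, 0, 0]
    have e1 := hall ![0, 1, 0, 0]
    have e2 := hall ![0, 0, 1, 0]
    have e3 := hall ![0, 0, 0, 1]
    simp [pointForm, hΛ] at e0 e1 e2 e3
    ext i
    fin_cases i <;> simpa

/-- The signs of a degenerate semidefinite configuration of three vectors in Lorentzian 3-space,
whose open cone is spacelike. -/
theorem exists_signs {p₁ p₂ p₃ m₁₂ m₁₃ m₂₃ : ℝ} (hp₁ : 0 ≤ p₁) (hp₂ : 0 ≤ p₂) (hp₃ : 0 ≤ p₃)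
    (h₁₂ : p₁ * p₂ = m₁₂ ^ 2) (h₁₃ : p₁ * p₃ = m₁₃ ^ 2) (h₂₃ : p₂ * p₃ = m₂₃ ^ 2)
    (hnd : ∀ b c d : ℝ, b * p₁ + c * m₁₂ + d * m₁₃ = 0 → b * m₁₂ + c * p₂ + d * m₂₃ = 0 →
      b * m₁₃ + c * m₂₃ + d * p₃ = 0 → b = 0 ∧ c = 0 ∧ d = 0)
    (hpos : ∀ b c d : ℝ, 0 < b → 0 < c → 0 < d → 0 < b ^ 2 * p₁ + c ^ 2 * p₂ + d ^ 2 * p₃ +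
      2 * (b * c * m₁₂ + b * d * m₁₃ + c * d * m₂₃)) :
    0 < p₁ ∧ 0 < p₂ ∧ 0 < p₃ ∧ ∃ s₁₂ s₁₃ s₂₃ : ℝ, s₁₂ ^ 2 = 1 ∧ s₁₃ ^ 2 = 1 ∧ s₂₃ ^ 2 = 1 ∧
      s₁₂ + s₁₃ + s₂₃ = 1 ∧ m₁₂ = s₁₂ * √p₁ * √p₂ ∧ m₁₃ = s₁₃ * √p₁ * √p₃ ∧
      m₂₃ = s₂₃ * √p₂ * √p₃ := by
  have q₁ : 0 < p₁ := by
    refine lt_of_le_of_ne hp₁ fun h => ?_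
    subst h
    have e1 : m₁₂ = 0 := by simpa using h₁₂.symm
    have e2 : m₁₃ = 0 := by simpa using h₁₃.symm
    simpa using (hnd 1 0 0 (by simp) (by simp [e1]) (by simp [e2])).1
  have q₂ : 0 < p₂ := by
    refine lt_of_le_of_ne hp₂ fun h => ?_
    subst h
    have e1 : m₁₂ = 0 := by simpa using h₁₂.symm
    have e2 : m₂₃ = 0 := by simpa using h₂₃.symm
    simpa using (hnd 0 1 0 (by simp [e1]) (by simp) (by simp [e2])).2.1
  have q₃ : 0 < p₃ := by
    refine lt_of_le_of_ne hp₃ fun h => ?_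
    subst h
    have e1 : m₁₃ = 0 := by simpa using h₁₃.symm
    have e2 : m₂₃ = 0 := by simpa using h₂₃.symm
    simpa using (hnd 0 0 1 (by simp [e1]) (by simp [e2]) (by simp)).2.2
  refine ⟨q₁, q₂, q₃, ?_⟩
  set l₁ := √p₁ with hl₁
  set l₂ := √p₂ with hl₂
  set l₃ := √p₃ with hl₃
  have r₁ : p₁ = l₁ ^ 2 := (Real.sq_sqrt hp₁).symm
  have r₂ : p₂ = l₂ ^ 2 := (Real.sq_sqrt hp₂).symm
  have r₃ : p₃ = l₃ ^ 2 := (Real.sq_sqrt hp₃).symm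
  have t₁ : 0 < l₁ := Real.sqrt_pos.2 q₁
  have t₂ : 0 < l₂ := Real.sqrt_pos.2 q₂
  have t₃ : 0 < l₃ := Real.sqrt_pos.2 q₃
  clear_value l₁ l₂ l₃
  subst r₁ r₂ r₃
  have sign : ∀ {a b m : ℝ}, 0 < a → 0 < b → a ^ 2 * b ^ 2 = m ^ 2 →
      ∃ s : ℝ, s ^ 2 = 1 ∧ (s = 1 ∨ s = -1) ∧ m = s * a * b := by
    intro a b m ha hb h
    rcases sq_eq_sq_iff_eq_or_eq_neg.1 ((mul_pow a b 2).trans h) with h | h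
    · exact ⟨1, by norm_num, Or.inl rfl, by linarith⟩
    · exact ⟨-1, by norm_num, Or.inr rfl, by linarith⟩
  obtain ⟨s₁₂, a₁₂, b₁₂, rfl⟩ := sign t₁ t₂ h₁₂
  obtain ⟨s₁₃, a₁₃, b₁₃, rfl⟩ := sign t₁ t₃ h₁₃
  obtain ⟨s₂₃, a₂₃, b₂₃, rfl⟩ := sign t₂ t₃ h₂₃
  refine ⟨s₁₂, s₁₃, s₂₃, a₁₂, a₁₃, a₂₃, ?_, rfl, rfl, rfl⟩
  -- If the signs were multiplicative, the Gram matrix would have rank one, with (l₂, -s₁₂ l₁, 0) in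
  -- its kernel.
  have hprod : s₁₃ ≠ s₁₂ * s₂₃ := by
    rintro rfl
    have h1 := (hnd l₂ (-s₁₂ * l₁) 0 (by linear_combination (-l₁ ^ 2 * l₂) * a₁₂) (by ring)
      (by ring)).1
    exact t₂.ne' h1
  -- These weights give the three vectors equal norm l₁l₂l₃. With all signs negative the form takes
  -- the value (3 - 6)(l₁l₂l₃)² on their sum.
  have hnot : ¬ (s₁₂ = -1 ∧ s₁₃ = -1 ∧ s₂₃ = -1) := by
    rintro ⟨rfl, rfl, rfl⟩
    have h1 := hpos (l₂ * l₃) (l₁ * l₃) (l₁ * l₂) (by positivity) (by positivity) (by positivity)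
    have h2 : 0 < l₁ ^ 2 * l₂ ^ 2 * l₃ ^ 2 := by positivity
    nlinarith
  rcases b₁₂ with rfl | rfl <;> rcases b₁₃ with rfl | rfl <;> rcases b₂₃ with rfl | rfl <;>
    first
    | (norm_num; done)
    | (norm_num at hprod; done)
    | norm_num at hnot

/-! ### Relabelling and rescaling the vertices -/

theorem geodesicSimplex_comp_perm (v : Fin 4 → R4) (e : Equiv.Perm (Fin 4)) :
    geodesicSimplex (v ∘ e) = geodesicSimplex v := by
  have hsum : ∀ a : Fin 4 → ℝ, ∑ i, a i • (v ∘ e) i = ∑ i, a (e.symm i) • v i := fun a => by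
    rw [← Equiv.sum_comp e (fun i => a (e.symm i) • v i)]
    simp
  ext p
  constructor
  · rintro ⟨a, ha, h, rfl⟩
    exact ⟨fun i => a (e.symm i), fun i => ha _, by rwa [← hsum], by simp only [hsum]⟩
  · rintro ⟨a, ha, h, rfl⟩
    have h1 : ∑ i, a (e i) • (v ∘ e) i = ∑ i, a i • v i := by
      rw [hsum fun i => a (e i)]
      simp
    exact ⟨fun i => a (e i), fun i => ha _, by rwa [h1], by simp only [h1]⟩

theorem geodesicSimplex_smul (v : Fin 4 → R4) {c : Fin 4 → ℝ} (hc : ∀ i, 0 < c i) :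
    geodesicSimplex (fun i => c i • v i) = geodesicSimplex v := by
  ext p
  constructor
  · rintro ⟨a, ha, h, rfl⟩
    have h1 : ∑ i, (a i * c i) • v i = ∑ i, a i • c i • v i := by simp only [mul_smul]
    exact ⟨fun i => a i * c i, fun i => mul_nonneg (ha i) (hc i).le, by rwa [h1], by simp only [h1]⟩
  · rintro ⟨a, ha, h, rfl⟩
    have h1 : ∑ i, (a i / c i) • c i • v i = ∑ i, a i • v i := by
      simp only [smul_smul, div_mul_cancel₀ _ (hc _).ne']
    exact ⟨fun i => a i / c i, fun i => div_nonneg (ha i) (hc i).le, by rwa [h1], by simp only [h1]⟩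

theorem span_image_smul (v : Fin 4 → R4) {c : Fin 4 → ℝ} (hc : ∀ i, 0 < c i) (s : Set (Fin 4)) :
    Submodule.span ℝ ((fun i => c i • v i) '' s) = Submodule.span ℝ (v '' s) := by
  refine le_antisymm (Submodule.span_le.2 ?_) (Submodule.span_le.2 ?_)
  · rintro _ ⟨i, hi, rfl⟩
    exact Submodule.smul_mem _ _ (Submodule.subset_span ⟨i, hi, rfl⟩)
  · rintro _ ⟨i, hi, rfl⟩
    have : v i = (c i)⁻¹ • c i • v i := by rw [inv_smul_smul₀ (hc i).ne']
    rw [SetLike.mem_coe, this]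
    exact Submodule.smul_mem _ _ (Submodule.subset_span ⟨i, hi, rfl⟩)

theorem IsLightlikeTetrahedron.comp_perm {Λ : SignType} {v : Fin 4 → R4}
    (hv : IsLightlikeTetrahedron Λ v) (e : Equiv.Perm (Fin 4)) :
    IsLightlikeTetrahedron Λ (v ∘ e) where
  nondegenerate := hv.nondegenerate.comp e e.injective
  subset_space := by
    rw [geodesicSimplex_comp_perm]
    exact hv.subset_space
  lightlike_faces i := by
    rw [Set.image_comp, Set.image_compl_eq e.bijective, Set.image_singleton]
    exact hv.lightlike_faces (e i)
  internal_spacelike i a ha := by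
    have := hv.internal_spacelike (e i) (fun j => a (e.symm j)) fun j => ha _
    rw [← Equiv.sum_comp e] at this
    simpa using this

theorem IsLightlikeTetrahedron.smul {Λ : SignType} {v : Fin 4 → R4}
    (hv : IsLightlikeTetrahedron Λ v) {c : Fin 4 → ℝ} (hc : ∀ i, 0 < c i) :
    IsLightlikeTetrahedron Λ (fun i => c i • v i) where
  nondegenerate := hv.nondegenerate.units_smul fun i => Units.mk0 (c i) (hc i).ne'
  subset_space := by
    rw [geodesicSimplex_smul v hc]
    exact hv.subset_space
  lightlike_faces i := by
    rw [span_image_smul v hc]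
    exact hv.lightlike_faces i
  internal_spacelike i a ha := by
    have h := hv.internal_spacelike i (fun j => a j * c j) fun j => mul_pos (ha j) (hc j)
    have h1 : Submodule.span ℝ {c i • v i, ∑ j, a j • c j • v j} =
        Submodule.span ℝ {v i, ∑ j, (a j * c j) • v j} := by
      rw [Submodule.span_insert, Submodule.span_insert,
        Submodule.span_singleton_smul_eq (IsUnit.mk0 _ (hc i).ne')]
      simp only [mul_smul]
    rwa [h1]

theorem IsLightlikeTetrahedron.pointForm_pos {Λ : SignType} {v : Fin 4 → R4}
    (hv : IsLightlikeTetrahedron Λ v) {a : Fin 4 → ℝ} (ha : ∀ i, 0 ≤ a i) (ha0 : a ≠ 0) :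
    0 < pointForm Λ (∑ i, a i • v i) (∑ i, a i • v i) := by
  have h : ∑ i, a i • v i ≠ 0 := fun h0 =>
    ha0 (funext (Fintype.linearIndependent_iff.1 hv.nondegenerate a h0))
  exact (mk_mem_spaceX Λ _ h).1 (hv.subset_space ⟨a, ha, h, rfl⟩)

theorem IsLightlikeTetrahedron.pointForm_segment_pos {Λ : SignType} {v : Fin 4 → R4}
    (hv : IsLightlikeTetrahedron Λ v) {i j : Fin 4} (hij : i ≠ j) {a b : ℝ} (ha : 0 ≤ a)
    (hb : 0 ≤ b) (hab : a + b ≠ 0) :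
    0 < pointForm Λ (a • v i + b • v j) (a • v i + b • v j) := by
  have h := hv.pointForm_pos (a := Pi.single i a + Pi.single j b) (fun k => by
    refine add_nonneg ?_ ?_ <;> simp only [Pi.single_apply] <;> split_ifs <;> simp [*]) (fun h0 => by
    have h1 := congrFun h0 i
    have h2 := congrFun h0 j
    simp [hij, hij.symm] at h1 h2
    exact hab (by simp [h1, h2]))
  have hs : ∑ k, (Pi.single i a + Pi.single j b : Fin 4 → ℝ) k • v k = a • v i + b • v j := by
    simp [add_smul, Finset.sum_add_distrib, Pi.single_apply, ite_smul]
  rwa [hs] at h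

theorem IsLightlikeTetrahedron.pointForm_vertex_pos {Λ : SignType} {v : Fin 4 → R4}
    (hv : IsLightlikeTetrahedron Λ v) (i : Fin 4) : 0 < pointForm Λ (v i) (v i) := by
  have : i ≠ i + 1 := by decide +revert
  simpa using hv.pointForm_segment_pos this zero_le_one le_rfl (by norm_num)

/-! ### The link of a vertex -/

/-- The metric at `[v i]` in the directions of `[v j]` and `[v k]`. -/
noncomputable def vertexForm (Λ : SignType) (v : Fin 4 → R4) (i j k : Fin 4) : ℝ :=
  ambientForm Λ (tangentPart Λ (v i) (v j)) (tangentPart Λ (v i) (v k))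

theorem vertexForm_comm (Λ : SignType) (v : Fin 4 → R4) (i j k : Fin 4) :
    vertexForm Λ v i j k = vertexForm Λ v i k j :=
  ambientForm_comm _ _ _

theorem IsLightlikePlane.gram_tangentPart {Λ : SignType} {x y z : R4} {U : Submodule ℝ R4}
    (hU : IsLightlikePlane Λ U) (hspan : U = Submodule.span ℝ {x, y, z})
    (hx : pointForm Λ x x = 1) :
    0 ≤ ambientForm Λ (tangentPart Λ x y) (tangentPart Λ x y) ∧
      ambientForm Λ (tangentPart Λ x y) (tangentPart Λ x y) *
        ambientForm Λ (tangentPart Λ x z) (tangentPart Λ x z) =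
      ambientForm Λ (tangentPart Λ x y) (tangentPart Λ x z) ^ 2 := by
  subst hspan
  have hxU : x ∈ Submodule.span ℝ {x, y, z} := Submodule.subset_span (by simp)
  have hyU : y ∈ Submodule.span ℝ {x, y, z} := Submodule.subset_span (by simp)
  have hzU : z ∈ Submodule.span ℝ {x, y, z} := Submodule.subset_span (by simp)
  refine hU.gram hx (pointForm_tangentPart hx y) (pointForm_tangentPart hx z) hxU
    (Submodule.sub_mem _ hyU (Submodule.smul_mem _ _ hxU))
    (Submodule.sub_mem _ hzU (Submodule.smul_mem _ _ hxU)) fun w hw => ?_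
  obtain ⟨a, b, c, rfl⟩ := Submodule.mem_span_triple.1 hw
  refine ⟨a + b * pointForm Λ x y + c * pointForm Λ x z, b, c, ?_⟩
  simp only [tangentPart]
  module

theorem tangentPart_sum_four {Λ : SignType} {v : Fin 4 → R4} (h0 : pointForm Λ (v 0) (v 0) = 1)
    (a : Fin 4 → ℝ) : tangentPart Λ (v 0) (∑ i, a i • v i) =
      a 1 • tangentPart Λ (v 0) (v 1) + a 2 • tangentPart Λ (v 0) (v 2) +
        a 3 • tangentPart Λ (v 0) (v 3) := by
  simp only [tangentPart, Fin.sum_univ_four, pointForm_add_right, pointForm_smul_right, h0]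
  module

/-- The sum 1 of the signs says that exactly one of them is -1. The hypotheses of `exists_signs`
come from the three lightlike faces through `v 0` (vanishing 2 × 2 minors), from linear independence
together with nondegeneracy of the metric (trivial kernel), and from the spacelike interior
directions (positivity). -/
theorem IsLightlikeTetrahedron.signs_zero {Λ : SignType} {v : Fin 4 → R4}
    (hv : IsLightlikeTetrahedron Λ v) (h0 : pointForm Λ (v 0) (v 0) = 1) :
    0 < vertexForm Λ v 0 1 1 ∧ 0 < vertexForm Λ v 0 2 2 ∧ 0 < vertexForm Λ v 0 3 3 ∧
    ∃ s₁₂ s₁₃ s₂₃ : ℝ, s₁₂ ^ 2 = 1 ∧ s₁₃ ^ 2 = 1 ∧ s₂₃ ^ 2 = 1 ∧ s₁₂ + s₁₃ + s₂₃ = 1 ∧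
      vertexForm Λ v 0 1 2 = s₁₂ * √(vertexForm Λ v 0 1 1) * √(vertexForm Λ v 0 2 2) ∧
      vertexForm Λ v 0 1 3 = s₁₃ * √(vertexForm Λ v 0 1 1) * √(vertexForm Λ v 0 3 3) ∧
      vertexForm Λ v 0 2 3 = s₂₃ * √(vertexForm Λ v 0 2 2) * √(vertexForm Λ v 0 3 3) := by
  have c1 : v '' {1}ᶜ = {v 0, v 2, v 3} := by
    rw [show ({1}ᶜ : Set (Fin 4)) = {0, 2, 3} by ext i; fin_cases i <;> simp]
    simp [Set.image_insert_eq]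
  have c2 : v '' {2}ᶜ = {v 0, v 3, v 1} := by
    rw [show ({2}ᶜ : Set (Fin 4)) = {0, 3, 1} by ext i; fin_cases i <;> simp]
    simp [Set.image_insert_eq]
  -- This face is used in both orders because `gram_tangentPart` gives nonnegativity only for the
  -- first of the two directions.
  have c2' : v '' {2}ᶜ = {v 0, v 1, v 3} := by
    rw [c2, Set.pair_comm]
  have c3 : v '' {3}ᶜ = {v 0, v 1, v 2} := by
    rw [show ({3}ᶜ : Set (Fin 4)) = {0, 1, 2} by ext i; fin_cases i <;> simp]
    simp [Set.image_insert_eq]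
  have f1 := (hv.lightlike_faces 1).gram_tangentPart (by rw [c1]) h0
  have f2 := (hv.lightlike_faces 2).gram_tangentPart (by rw [c2']) h0
  have f2' := (hv.lightlike_faces 2).gram_tangentPart (by rw [c2]) h0
  have f3 := (hv.lightlike_faces 3).gram_tangentPart (by rw [c3]) h0
  refine exists_signs f2.1 f1.1 f2'.1 f3.2 f2.2 f1.2 ?_ ?_
  · intro b c d e1 e2 e3
    set z := b • tangentPart Λ (v 0) (v 1) + c • tangentPart Λ (v 0) (v 2) +
      d • tangentPart Λ (v 0) (v 3) with hz
    have hzt : pointForm Λ (v 0) z = 0 := by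
      simp only [hz, pointForm_add_right, pointForm_smul_right, pointForm_tangentPart h0]
      ring
    have hz1 : ∀ j, ambientForm Λ z (tangentPart Λ (v 0) (v j)) =
        b * vertexForm Λ v 0 j 1 + c * vertexForm Λ v 0 j 2 + d * vertexForm Λ v 0 j 3 := by
      intro j
      rw [ambientForm_comm]
      simp only [hz, ambientForm_add_right, ambientForm_smul_right, vertexForm]
    have hz0 : z = 0 := by
      refine eq_zero_of_forall_tangent h0 hzt fun y hy => ?_
      have hspan := hv.nondegenerate.span_eq_top_of_card_eq_finrank (by simp)
      obtain ⟨a, rfl⟩ := (Submodule.mem_span_range_iff_exists_fun ℝ).1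
        (hspan ▸ Submodule.mem_top : y ∈ Submodule.span ℝ (Set.range v))
      have hy' : ∑ i, a i • v i = tangentPart Λ (v 0) (∑ i, a i • v i) := by
        rw [tangentPart, hy, zero_smul, sub_zero]
      rw [hy', tangentPart_sum_four h0, ambientForm_add_right, ambientForm_add_right,
        ambientForm_smul_right, ambientForm_smul_right, ambientForm_smul_right, hz1, hz1, hz1,
        vertexForm_comm Λ v 0 2 1, vertexForm_comm Λ v 0 3 1, vertexForm_comm Λ v 0 3 2]
      have e1' : b * vertexForm Λ v 0 1 1 + c * vertexForm Λ v 0 1 2 + d * vertexForm Λ v 0 1 3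
        = 0 := e1
      have e2' : b * vertexForm Λ v 0 1 2 + c * vertexForm Λ v 0 2 2 + d * vertexForm Λ v 0 2 3
        = 0 := e2
      have e3' : b * vertexForm Λ v 0 1 3 + c * vertexForm Λ v 0 2 3 + d * vertexForm Λ v 0 3 3
        = 0 := e3
      rw [e1', e2', e3']
      ring
    have hli := Fintype.linearIndependent_iff.1 hv.nondegenerate
      ![-(b * pointForm Λ (v 0) (v 1) + c * pointForm Λ (v 0) (v 2) +
        d * pointForm Λ (v 0) (v 3)), b, c, d] (by
        rw [← hz0, hz, Fin.sum_univ_four]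
        simp only [tangentPart, Matrix.cons_val]
        module)
    exact ⟨hli 1, hli 2, hli 3⟩
  · intro b c d hb hc hd
    have ha : ∀ j, 0 < (![1, b, c, d] : Fin 4 → ℝ) j := by
      intro j
      fin_cases j <;> simp [hb, hc, hd]
    have hs := hv.internal_spacelike 0 _ ha
    set x := ∑ j, (![1, b, c, d] : Fin 4 → ℝ) j • v j with hx
    have hxt : tangentPart Λ (v 0) x = b • tangentPart Λ (v 0) (v 1) +
        c • tangentPart Λ (v 0) (v 2) + d • tangentPart Λ (v 0) (v 3) :=
      tangentPart_sum_four h0 _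
    have hv0 : v 0 ∈ Submodule.span ℝ {v 0, x} := Submodule.subset_span (by simp)
    have hne : tangentPart Λ (v 0) x ≠ 0 := by
      intro h
      have hli := Fintype.linearIndependent_iff.1 hv.nondegenerate
        ![1 - pointForm Λ (v 0) x, b, c, d] (by
          rw [← h, tangentPart, hx, Fin.sum_univ_four, Fin.sum_univ_four]
          simp only [Matrix.cons_val]
          module) 1
      exact hb.ne' hli
    have hp := hs.2 _ hv0 h0 _ (Submodule.sub_mem _ (Submodule.subset_span (by simp))
      (Submodule.smul_mem _ _ hv0)) hne (pointForm_tangentPart h0 x)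
    have hp' : 0 < ambientForm Λ (tangentPart Λ (v 0) x) (tangentPart Λ (v 0) x) := hp
    rw [hxt] at hp'
    convert hp' using 1
    simp only [vertexForm, ambientForm, Pi.add_apply, Pi.smul_apply, smul_eq_mul]
    ring

theorem IsLightlikeTetrahedron.signs {Λ : SignType} {v : Fin 4 → R4}
    (hv : IsLightlikeTetrahedron Λ v) (h1 : ∀ i, pointForm Λ (v i) (v i) = 1) {i j k m : Fin 4}
    (hij : i ≠ j) (hik : i ≠ k) (him : i ≠ m) (hjk : j ≠ k) (hjm : j ≠ m) (hkm : k ≠ m) :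
    0 < vertexForm Λ v i j j ∧ 0 < vertexForm Λ v i k k ∧ 0 < vertexForm Λ v i m m ∧
    ∃ s₁₂ s₁₃ s₂₃ : ℝ, s₁₂ ^ 2 = 1 ∧ s₁₃ ^ 2 = 1 ∧ s₂₃ ^ 2 = 1 ∧ s₁₂ + s₁₃ + s₂₃ = 1 ∧
      vertexForm Λ v i j k = s₁₂ * √(vertexForm Λ v i j j) * √(vertexForm Λ v i k k) ∧
      vertexForm Λ v i j m = s₁₃ * √(vertexForm Λ v i j j) * √(vertexForm Λ v i m m) ∧
      vertexForm Λ v i k m = s₂₃ * √(vertexForm Λ v i k k) * √(vertexForm Λ v i m m) := by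
  have hinj : Function.Injective ![i, j, k, m] := by
    intro a b
    fin_cases a <;> fin_cases b <;>
      simp [hij, hij.symm, hik, hik.symm, him, him.symm, hjk, hjk.symm, hjm, hjm.symm, hkm, hkm.symm]
  exact (hv.comp_perm (Equiv.ofBijective _ (Finite.injective_iff_bijective.1 hinj))).signs_zero
    (h1 i)

/-! ### Distances -/

/-- The distance of the points `[v]`, `[w]` with normalized representatives `v`, `w`, if they are
joined by a spacelike segment. -/
noncomputable def genDist (Λ : SignType) (v w : R4) : ℝ :=
  match Λ with
  | .pos => Real.arccos (pointForm 1 v w)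
  | .neg => Real.arcosh (pointForm (-1) v w)
  | .zero => √(ambientForm 0 (v - w) (v - w))

theorem genDist_comm (Λ : SignType) (v w : R4) : genDist Λ v w = genDist Λ w v := by
  rcases Λ with _ | _ | _
  · simp only [genDist]
    congr 1
    simp only [ambientForm, Pi.sub_apply]
    ring
  · simp only [genDist, pointForm_comm _ v w]
  · simp only [genDist, pointForm_comm _ v w]

theorem ambientForm_tangentPart {Λ : SignType} (h : Λ ≠ 0) {u : R4} (hu : pointForm Λ u u = 1)
    (v w : R4) : ambientForm Λ (tangentPart Λ u v) (tangentPart Λ u w) =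
      Λ * (pointForm Λ v w - pointForm Λ u v * pointForm Λ u w) := by
  rw [ambientForm_eq_mul_pointForm h]
  have e1 : tangentPart Λ u w = w + (-pointForm Λ u w) • u := by rw [tangentPart]; module
  have e2 : tangentPart Λ u v = v + (-pointForm Λ u v) • u := by rw [tangentPart]; module
  rw [e1, pointForm_add_right, pointForm_smul_right, pointForm_comm Λ _ w, pointForm_comm Λ _ u,
    pointForm_tangentPart hu, e2, pointForm_add_right, pointForm_smul_right, pointForm_comm Λ w u,
    pointForm_comm Λ w v]
  ring

theorem pointForm_zero_eq_one {v w : R4} (hv : pointForm 0 v v = 1) (hw : pointForm 0 w w = 1)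
    (hG : -1 < pointForm 0 v w) : pointForm 0 v w = 1 := by
  simp only [pointForm_zero_eq] at *
  have h : (v 1 * w 1) ^ 2 = 1 := by linear_combination hv * (w 1 * w 1) + hw
  rcases sq_eq_one_iff.1 h with h | h <;> linarith

/-- For Λ ≠ 0 the tangential part of `w` has square Λ(1 - G²) with G = ⟨v,w⟩. Its positivity,
together with G > -1, puts G in (-1,1) or (1,∞), where arccos or arcosh inverts. For Λ = 0 the bound
on G says that both points lie on the same sheet x₂ = 1 or x₂ = -1. -/
theorem genDist_spec {Λ : SignType} {v w : R4} (hv : pointForm Λ v v = 1)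
    (hw : pointForm Λ w w = 1) (hG : -1 < pointForm Λ v w)
    (hT : 0 < ambientForm Λ (tangentPart Λ v w) (tangentPart Λ v w)) :
    IsGenAngle Λ (genDist Λ v w) ∧ genCos Λ (genDist Λ v w) = pointForm Λ v w ∧
      genSin Λ (genDist Λ v w) ^ 2 =
        ambientForm Λ (tangentPart Λ v w) (tangentPart Λ v w) := by
  rcases Λ with _ | _ | _
  · have h1 := pointForm_zero_eq_one hv hw hG
    have h2 : tangentPart 0 v w = w - v := by rw [tangentPart, h1, one_smul]
    have h3 : genDist 0 v w = √(ambientForm 0 (tangentPart 0 v w) (tangentPart 0 v w)) := by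
      rw [h2, genDist_comm]; rfl
    simp only [SignType.zero_eq_zero] at *
    refine ⟨⟨?_, by simp⟩, ?_, ?_⟩
    · rw [h3]
      exact Real.sqrt_pos.2 hT
    · rw [h1]; rfl
    · rw [h3]
      exact Real.sq_sqrt hT.le
  · simp only [SignType.neg_eq_neg_one] at *
    rw [ambientForm_tangentPart (by decide) hv, hw] at hT ⊢
    simp only [SignType.coe_neg_one] at hT ⊢
    have h1 : 1 < pointForm (-1) v w := by nlinarith
    have h2 : genDist (-1) v w = Real.arcosh (pointForm (-1) v w) := rfl
    have h3 : genCos (-1) (genDist (-1) v w) = pointForm (-1) v w := by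
      rw [h2]
      exact Real.cosh_arcosh h1.le
    refine ⟨⟨?_, fun h => absurd h (by decide)⟩, h3, ?_⟩
    · rw [h2]
      exact Real.arcosh_pos h1
    · have := genCos_sq_add (-1) (genDist (-1) v w)
      rw [h3, SignType.coe_neg_one] at this
      linarith
  · simp only [SignType.pos_eq_one] at *
    rw [ambientForm_tangentPart (by decide) hv, hw] at hT ⊢
    simp only [SignType.coe_one] at hT ⊢
    have h1 : pointForm 1 v w < 1 := by nlinarith
    have h2 : genDist 1 v w = Real.arccos (pointForm 1 v w) := rfl
    have h3 : genCos 1 (genDist 1 v w) = pointForm 1 v w := by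
      rw [h2]
      exact Real.cos_arccos hG.le h1.le
    refine ⟨⟨?_, fun _ => ?_⟩, h3, ?_⟩
    · rw [h2]
      exact Real.arccos_pos.2 h1
    · rw [h2]
      exact lt_of_le_of_ne (Real.arccos_le_pi _) fun h => by
        have := Real.arccos_eq_pi.1 h
        linarith
    · have := genCos_sq_add 1 (genDist 1 v w)
      rw [h3, SignType.coe_one] at this
      linarith

theorem eq_of_genCos_eq {Λ : SignType} (h : Λ ≠ 0) {x y : ℝ} (hx : 0 ≤ x)
    (hx' : Λ = 1 → x ≤ Real.pi) (hy : 0 ≤ y) (hy' : Λ = 1 → y ≤ Real.pi)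
    (hxy : genCos Λ x = genCos Λ y) : x = y := by
  rcases SignType.trichotomy Λ with rfl | rfl | rfl
  · have h1 : Real.cosh x = Real.cosh y := hxy
    have h2 := Real.cosh_le_cosh.1 h1.le
    have h3 := Real.cosh_le_cosh.1 h1.ge
    rw [abs_of_nonneg hx, abs_of_nonneg hy] at h2 h3
    exact le_antisymm h2 h3
  · exact absurd rfl h
  · exact Real.injOn_cos ⟨hx, hx' rfl⟩ ⟨hy, hy' rfl⟩ hxy

theorem genCos_abs (Λ : SignType) (x : ℝ) : genCos Λ |x| = genCos Λ x := by
  rcases abs_choice x with h | h <;> rw [h]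
  exact genCos_neg Λ x

/-- The sides of a triangle in a lightlike plane. -/
theorem genDist_triangle {Λ : SignType} {u v w : R4} {a b c s : ℝ} (hu : pointForm Λ u u = 1)
    (ha : IsGenAngle Λ a) (hb : IsGenAngle Λ b) (hc : IsGenAngle Λ c)
    (hCa : genCos Λ a = pointForm Λ u v) (hCb : genCos Λ b = pointForm Λ u w)
    (hCc : genCos Λ c = pointForm Λ v w)
    (hSa : genSin Λ a ^ 2 = ambientForm Λ (tangentPart Λ u v) (tangentPart Λ u v))
    (hSb : genSin Λ b ^ 2 = ambientForm Λ (tangentPart Λ u w) (tangentPart Λ u w))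
    (hSc : genSin Λ c ^ 2 = ambientForm Λ (tangentPart Λ v w) (tangentPart Λ v w))
    (h : ambientForm Λ (tangentPart Λ u v) (tangentPart Λ u w) = s * genSin Λ a * genSin Λ b) :
    (s = 1 → c = |a - b|) ∧ (s = -1 → c = a + b ∨ (Λ = 1 ∧ a + b + c = 2 * Real.pi)) := by
  by_cases h0 : Λ = 0
  · subst h0
    have e1 : pointForm 0 u v = 1 := hCa.symm
    have e2 : pointForm 0 u w = 1 := hCb.symm
    have e3 : pointForm 0 v w = 1 := hCc.symm
    -- The Euclidean law of cosines, with s in the role of the cosine of the angle.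
    have e4 : c ^ 2 = a ^ 2 + b ^ 2 - 2 * (s * a * b) := by
      change a ^ 2 = _ at hSa
      change b ^ 2 = _ at hSb
      change c ^ 2 = _ at hSc
      change _ = s * a * b at h
      rw [hSc, hSa, hSb, ← h]
      simp only [tangentPart, e1, e2, e3, one_smul, ambientForm, Pi.sub_apply]
      ring
    constructor
    · rintro rfl
      rw [← abs_of_pos hc.1]
      exact (sq_eq_sq_iff_abs_eq_abs _ _).1 (by rw [e4]; ring)
    · rintro rfl
      left
      exact (sq_eq_sq₀ hc.1.le (add_pos ha.1 hb.1).le).1 (by rw [e4]; ring)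
  · rw [ambientForm_tangentPart h0 hu] at h
    -- The law of cosines; for s = ±1 its right side is the generalized cosine of a ∓ b.
    have e1 : genCos Λ c = genCos Λ a * genCos Λ b + Λ * (s * (genSin Λ a * genSin Λ b)) := by
      rw [hCa, hCb, hCc]
      linear_combination Λ * h - (pointForm Λ v w - pointForm Λ u v * pointForm Λ u w) *
        sq_cast_of_ne_zero h0
    constructor
    · rintro rfl
      refine eq_of_genCos_eq h0 hc.1.le (fun h => (hc.2 h).le) (abs_nonneg _) (fun h => ?_) ?_
      · have := ha.1
        have := hb.1
        have := ha.2 h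
        have := hb.2 h
        rw [abs_le]
        constructor <;> linarith
      · rw [genCos_abs, genCos_sub, e1]
        ring
    · rintro rfl
      have e2 : genCos Λ c = genCos Λ (a + b) := by
        rw [genCos_add, e1]
        ring
      -- In de Sitter space a + b may exceed π. Then c, which is below π, has the same cosine as 2π
      -- - (a + b).
      by_cases hab : Λ = 1 → a + b ≤ Real.pi
      · exact Or.inl (eq_of_genCos_eq h0 hc.1.le (fun h => (hc.2 h).le) (add_pos ha.1 hb.1).le
          hab e2)
      · right
        obtain ⟨rfl, hab⟩ := Classical.not_imp.1 hab
        have e3 : genCos 1 (a + b) = genCos 1 (2 * Real.pi - (a + b)) :=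
          (Real.cos_two_pi_sub (a + b)).symm
        have := ha.2 rfl
        have := hb.2 rfl
        have := eq_of_genCos_eq h0 hc.1.le (fun h => (hc.2 h).le) (by linarith)
          (fun _ => by linarith) (e2.trans e3)
        exact ⟨rfl, by linarith⟩

/-- The combinatorics of the edge lengths. -/
theorem exists_perm_of_triangles {l : Fin 4 → Fin 4 → ℝ}
    {s : Fin 4 → Fin 4 → Fin 4 → ℝ} (hl : ∀ i j, l i j = l j i) (hs : ∀ i j k, s i j k = s i k j)
    (hpos : ∀ i j, i ≠ j → 0 < l i j)
    (hs1 : ∀ i j k, i ≠ j → i ≠ k → j ≠ k → s i j k = 1 ∨ s i j k = -1)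
    (hsum : ∀ i j k m, i ≠ j → i ≠ k → i ≠ m → j ≠ k → j ≠ m → k ≠ m →
      s i j k + s i j m + s i k m = 1)
    (hplus : ∀ i j k, i ≠ j → i ≠ k → j ≠ k → s i j k = 1 → l j k = |l i j - l i k|)
    (hminus : ∀ i j k, i ≠ j → i ≠ k → j ≠ k → s i j k = -1 →
      l j k = l i j + l i k ∨ (l i j + l i k + l j k = 2 * Real.pi ∧ l i j < Real.pi ∧
        l i k < Real.pi ∧ l j k < Real.pi)) :
    ∃ e : Equiv.Perm (Fin 4), l (e 0) (e 3) = l (e 1) (e 2) ∧ l (e 1) (e 3) = l (e 0) (e 2) ∧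
      l (e 2) (e 3) = l (e 0) (e 1) ∧ l (e 0) (e 1) = l (e 0) (e 3) + l (e 0) (e 2) := by
  -- Three plus signs would make each side the difference of the other two, which is impossible for
  -- the longest side.
  have tri : ∀ i j k, i ≠ j → i ≠ k → j ≠ k → s i j k + s j i k + s k i j ≤ 1 := by
    intro i j k hij hik hjk
    rcases hs1 i j k hij hik hjk with h1 | h1 <;> rcases hs1 j i k hij.symm hjk hik with h2 | h2 <;>
      rcases hs1 k i j hik.symm hjk.symm hij with h3 | h3 <;> rw [h1, h2, h3] <;> norm_num
    have e1 := hplus i j k hij hik hjk h1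
    have e2 := hplus j i k hij.symm hjk hik h2
    have e3 := hplus k i j hik.symm hjk.symm hij h3
    have p1 := hpos i j hij
    have p2 := hpos i k hik
    have p3 := hpos j k hjk
    rw [hl j i] at e2
    rw [hl k i, hl k j] at e3
    rcases abs_choice (l i j - l i k) with q1 | q1 <;> rcases abs_choice (l i j - l j k) with q2 | q2
      <;> rcases abs_choice (l i k - l j k) with q3 | q3 <;> linarith
  -- A further angle of this triangle has sign +1, so one side is the sum of two others. Perimeter
  -- 2π would then give a side of length π.
  have one : ∀ i j k, i ≠ j → i ≠ k → j ≠ k → s i j k + s j i k + s k i j = 1 → s i j k = -1 →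
      l j k = l i j + l i k := by
    intro i j k hij hik hjk h h1
    rcases hminus i j k hij hik hjk h1 with h2 | ⟨h2, h3, h4, h5⟩
    · exact h2
    rcases hs1 j i k hij.symm hjk hik with h6 | h6
    · have e2 := hplus j i k hij.symm hjk hik h6
      rw [hl j i] at e2
      rcases abs_choice (l i j - l j k) with q2 | q2 <;> linarith
    · rcases hs1 k i j hik.symm hjk.symm hij with h7 | h7 <;> rw [h1, h6, h7] at h <;> norm_num at h
  have tri2 : ∀ i j k, i ≠ j → i ≠ k → j ≠ k → s i j k + s j i k + s k i j = 1 →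
      (s i j k = -1 ∧ l j k = l i j + l i k) ∨ (s j i k = -1 ∧ l i k = l i j + l j k) ∨
        (s k i j = -1 ∧ l i j = l i k + l j k) := by
    intro i j k hij hik hjk h
    by_cases h1 : s i j k = -1
    · exact Or.inl ⟨h1, one i j k hij hik hjk h h1⟩
    by_cases h2 : s j i k = -1
    · refine Or.inr (Or.inl ⟨h2, ?_⟩)
      rw [one j i k hij.symm hjk hik (by rw [hs k j i]; linarith) h2, hl j i]
    by_cases h3 : s k i j = -1
    · refine Or.inr (Or.inr ⟨h3, ?_⟩)
      rw [one k i j hik.symm hjk.symm hij (by rw [hs i k j, hs j k i]; linarith) h3, hl k i, hl k j]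
    have h1' := (hs1 i j k hij hik hjk).resolve_right h1
    have h2' := (hs1 j i k hij.symm hjk hik).resolve_right h2
    have h3' := (hs1 k i j hik.symm hjk.symm hij).resolve_right h3
    rw [h1', h2', h3'] at h
    norm_num at h
  have hle : ∀ i j k, i ≠ j → i ≠ k → j ≠ k → s i j k ≤ 1 := by
    intro i j k hij hik hjk
    rcases hs1 i j k hij hik hjk with h | h <;> rw [h]
    norm_num
  -- Double counting: the twelve signs add up to 4 over the vertices and to at most 1 on each of the
  -- four faces, so every face has sum exactly 1.
  have n0 := hsum 0 1 2 3 (by decide) (by decide) (by decide) (by decide) (by decide) (by decide)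
  have n1 := hsum 1 0 2 3 (by decide) (by decide) (by decide) (by decide) (by decide) (by decide)
  have n2 := hsum 2 0 1 3 (by decide) (by decide) (by decide) (by decide) (by decide) (by decide)
  have n3 := hsum 3 0 1 2 (by decide) (by decide) (by decide) (by decide) (by decide) (by decide)
  have t0 := tri 1 2 3 (by decide) (by decide) (by decide)
  have t1 := tri 0 2 3 (by decide) (by decide) (by decide)
  have t2 := tri 0 1 3 (by decide) (by decide) (by decide)
  have t3 := tri 0 1 2 (by decide) (by decide) (by decide)
  have u0 := tri2 1 2 3 (by decide) (by decide) (by decide) (by linarith)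
  have u1 := tri2 0 2 3 (by decide) (by decide) (by decide) (by linarith)
  have u2 := tri2 0 1 3 (by decide) (by decide) (by decide) (by linarith)
  have u3 := tri2 0 1 2 (by decide) (by decide) (by decide) (by linarith)
  have p01 := hpos 0 1 (by decide)
  have p02 := hpos 0 2 (by decide)
  have p03 := hpos 0 3 (by decide)
  have p12 := hpos 1 2 (by decide)
  have p13 := hpos 1 3 (by decide)
  have p23 := hpos 2 3 (by decide)
  have b0 := hle 0 1 2 (by decide) (by decide) (by decide)
  have b1 := hle 0 1 3 (by decide) (by decide) (by decide)
  have b2 := hle 0 2 3 (by decide) (by decide) (by decide)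
  have b3 := hle 1 0 2 (by decide) (by decide) (by decide)
  have b4 := hle 1 0 3 (by decide) (by decide) (by decide)
  have b5 := hle 1 2 3 (by decide) (by decide) (by decide)
  have b6 := hle 2 0 1 (by decide) (by decide) (by decide)
  have b7 := hle 2 0 3 (by decide) (by decide) (by decide)
  have b8 := hle 2 1 3 (by decide) (by decide) (by decide)
  have b9 := hle 3 0 1 (by decide) (by decide) (by decide)
  have b10 := hle 3 0 2 (by decide) (by decide) (by decide)
  have b11 := hle 3 1 2 (by decide) (by decide) (by decide)
  -- Of the 81 ways to choose the straight angle in each face, the survivors fall into three cases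
  -- according to which pair of opposite edges is longest.
  have cases : (l 0 3 = l 1 2 ∧ l 1 3 = l 0 2 ∧ l 2 3 = l 0 1 ∧ l 0 1 = l 0 3 + l 0 2) ∨
      (l 0 3 = l 1 2 ∧ l 2 3 = l 0 1 ∧ l 1 3 = l 0 2 ∧ l 0 2 = l 0 3 + l 0 1) ∨
      (l 0 1 = l 2 3 ∧ l 1 3 = l 0 2 ∧ l 1 2 = l 0 3 ∧ l 0 3 = l 0 1 + l 0 2) := by
    clear hs hpos hs1 hsum hplus hminus tri one tri2 hle t0 t1 t2 t3 hl
    rcases u0 with ⟨u0, w0⟩ | ⟨u0, w0⟩ | ⟨u0, w0⟩ <;> rcases u1 with ⟨u1, w1⟩ | ⟨u1, w1⟩ | ⟨u1, w1⟩ <;>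
    rcases u2 with ⟨u2, w2⟩ | ⟨u2, w2⟩ | ⟨u2, w2⟩ <;> rcases u3 with ⟨u3, w3⟩ | ⟨u3, w3⟩ | ⟨u3, w3⟩ <;>
    first
    | (exfalso; linarith)
    | exact Or.inl ⟨by linarith, by linarith, by linarith, by linarith⟩
    | exact Or.inr (Or.inl ⟨by linarith, by linarith, by linarith, by linarith⟩)
    | exact Or.inr (Or.inr ⟨by linarith, by linarith, by linarith, by linarith⟩)
  rcases cases with ⟨h1, h2, h3, h4⟩ | ⟨h1, h2, h3, h4⟩ | ⟨h1, h2, h3, h4⟩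
  · exact ⟨1, h1, h2, h3, h4⟩
  · exact ⟨Equiv.swap 1 2, h1.trans (hl 1 2), h2, h3, h4⟩
  · exact ⟨Equiv.swap 1 3, h1.trans (hl 2 3), (hl 3 1).trans h2, (hl 2 1).trans h3, h4⟩

/-! ### Lengths of segments -/

theorem IsGenAngle.genSin_nonneg {Λ : SignType} {l r : ℝ} (hl : IsGenAngle Λ l)
    (hr : r ∈ Set.Icc 0 l) : 0 ≤ genSin Λ r := by
  rcases hr.1.eq_or_lt with h | h
  · rw [← h, genSin_zero]
  · exact (hl.mono h hr.2).genSin_pos.le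

/-- The integrand is the speed of the segment in its linear parameter t; substituting arc length r
turns it into the constant 1. -/
theorem integral_segment {Λ : SignType} {l a d : ℝ} (hl : IsGenAngle Λ l) (ha : 0 < a)
    (hd : 0 < d) (hq : ∀ t ∈ Set.Icc (0 : ℝ) 1, 0 < ((1 - t) * a) ^ 2 +
      2 * ((1 - t) * a) * (t * d) * genCos Λ l + (t * d) ^ 2) :
    ∫ t in (0 : ℝ)..1, a * d * genSin Λ l / (((1 - t) * a) ^ 2 +
      2 * ((1 - t) * a) * (t * d) * genCos Λ l + (t * d) ^ 2) = l := by
  have hS := hl.genSin_pos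
  -- The point at distance r from `v` is proportional to s(l - r) v + s(r) w. Matching coefficients
  -- with (1 - t) a v + t d w gives t = a s(r) / `den` r.
  set den : ℝ → ℝ := fun r => a * genSin Λ r + d * genSin Λ (l - r) with hden
  have hden_pos : ∀ r ∈ Set.Icc 0 l, 0 < den r := by
    intro r hr
    have h1 := hl.genSin_nonneg hr
    have h2 := hl.genSin_nonneg (r := l - r) ⟨by linarith [hr.2], by linarith [hr.1]⟩
    rcases hr.1.eq_or_lt with h | h
    · simp only [hden, ← h, genSin_zero, sub_zero]
      positivity
    · have := (hl.mono h hr.2).genSin_pos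
      simp only [hden]
      positivity
  have hderiv : ∀ r ∈ Set.Icc 0 l, HasDerivAt (fun r => a * genSin Λ r / den r)
      (a * d * genSin Λ l / den r ^ 2) r := by
    intro r hr
    have hne := (hden_pos r hr).ne'
    have h1 := (hasDerivAt_genSin Λ r).const_mul a
    have h2 : HasDerivAt (fun r => genSin Λ (l - r)) (-genCos Λ (l - r)) r := by
      simpa using (hasDerivAt_genSin Λ (l - r)).comp_const_sub l r
    refine (h1.div (h1.add (h2.const_mul d)) hne).congr_deriv ?_
    congr 1
    have h3 : genSin Λ l = genSin Λ r * genCos Λ (l - r) + genCos Λ r * genSin Λ (l - r) := by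
      rw [← genSin_add]
      ring_nf
    rw [h3]
    simp only [Pi.add_apply]
    ring
  have hmem : ∀ r ∈ Set.Icc 0 l, a * genSin Λ r / den r ∈ Set.Icc (0 : ℝ) 1 := by
    intro r hr
    have h1 := hl.genSin_nonneg hr
    have h2 := hl.genSin_nonneg (r := l - r) ⟨by linarith [hr.2], by linarith [hr.1]⟩
    refine ⟨div_nonneg (by positivity) (hden_pos r hr).le,
      (div_le_one (hden_pos r hr)).2 ?_⟩
    simp only [hden]
    linarith [mul_nonneg hd.le h2]
  have hcden : Continuous den :=
    ((continuous_genSin Λ).const_mul a).add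
      (((continuous_genSin Λ).comp (continuous_const.sub continuous_id)).const_mul d)
  have key := intervalIntegral.integral_comp_mul_deriv'' (a := 0) (b := l)
    (f := fun r => a * genSin Λ r / den r) (f' := fun r => a * d * genSin Λ l / den r ^ 2)
    (g := fun t => a * d * genSin Λ l / (((1 - t) * a) ^ 2 +
      2 * ((1 - t) * a) * (t * d) * genCos Λ l + (t * d) ^ 2))
    (fun r hr => (hderiv r (by rwa [Set.uIcc_of_le hl.1.le] at hr)).continuousAt.continuousWithinAt)
    (fun r hr => (hderiv r (by
      rw [min_eq_left hl.1.le, max_eq_right hl.1.le] at hr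
      exact ⟨hr.1.le, hr.2.le⟩)).hasDerivWithinAt)
    (by
      rw [Set.uIcc_of_le hl.1.le]
      exact continuousOn_const.div (hcden.pow 2).continuousOn
        fun r hr => (pow_pos (hden_pos r hr) 2).ne')
    (by
      rw [Set.uIcc_of_le hl.1.le]
      refine continuousOn_const.div (by fun_prop) ?_
      rintro _ ⟨r, hr, rfl⟩
      exact (hq _ (hmem r hr)).ne')
  have e0 : a * genSin Λ 0 / den 0 = 0 := by simp [genSin_zero]
  have e1 : a * genSin Λ l / den l = 1 := by
    simp only [hden, sub_self, genSin_zero, mul_zero, add_zero]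
    field_simp
  simp only [e0, e1] at key
  rw [← key]
  trans ∫ _ in (0 : ℝ)..l, (1 : ℝ)
  · refine intervalIntegral.integral_congr fun r hr => ?_
    rw [Set.uIcc_of_le hl.1.le] at hr
    have hne := (hden_pos r hr).ne'
    have hq' := (hq _ (hmem r hr)).ne'
    have h2 : genSin Λ (l - r) = genSin Λ l * genCos Λ r - genCos Λ l * genSin Λ r :=
      genSin_sub Λ l r
    have hqe : ((1 - a * genSin Λ r / den r) * a) ^ 2 +
        2 * ((1 - a * genSin Λ r / den r) * a) * (a * genSin Λ r / den r * d) * genCos Λ l +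
        (a * genSin Λ r / den r * d) ^ 2 = (a * d * genSin Λ l) ^ 2 / den r ^ 2 := by
      have h3 : 1 - a * genSin Λ r / den r = d * genSin Λ (l - r) / den r := by
        field_simp
        simp only [hden]
        ring
      rw [h3]
      field_simp
      rw [h2]
      linear_combination (genSin Λ l ^ 2) * genCos_sq_add Λ r - (genSin Λ r ^ 2) * genCos_sq_add Λ l
    simp only [Function.comp]
    rw [hqe]
    field_simp
  · simp

/-- In the orthogonal frame formed by `v` and the tangential part of `w`, the normalized curve is A
v + B u. By `ambientForm_of_tangent` its speed is the Wronskian A B' - B A' times s(l), which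
simplifies to a d s(l) / q(t). -/
theorem segmentLength_eq {Λ : SignType} {v w : R4} {l a d : ℝ} (hv : pointForm Λ v v = 1)
    (hw : pointForm Λ w w = 1) (hl : IsGenAngle Λ l) (hC : genCos Λ l = pointForm Λ v w)
    (hS : genSin Λ l ^ 2 = ambientForm Λ (tangentPart Λ v w) (tangentPart Λ v w))
    (hpos : ∀ x y : ℝ, 0 ≤ x → 0 ≤ y → x + y ≠ 0 → 0 < pointForm Λ (x • v + y • w) (x • v + y • w))
    (ha : 0 < a) (hd : 0 < d) : segmentLength Λ (a • v) (d • w) = l := by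
  set q : ℝ → ℝ := fun t => ((1 - t) * a) ^ 2 +
      2 * ((1 - t) * a) * (t * d) * genCos Λ l + (t * d) ^ 2 with hq
  have hqe : ∀ t, pointForm Λ ((1 - t) • a • v + t • d • w) ((1 - t) • a • v + t • d • w) = q t := by
    intro t
    rw [smul_smul, smul_smul, pointForm_combination, hv, hw, ← hC]
    simp only [hq]
    ring
  have hqpos : ∀ t ∈ Set.Icc (0 : ℝ) 1, 0 < q t := by
    intro t ht
    rw [← hqe, smul_smul, smul_smul]
    have h1 : 0 ≤ (1 - t) * a := mul_nonneg (by linarith [ht.2]) ha.le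
    have h2 : 0 ≤ t * d := mul_nonneg ht.1 hd.le
    refine hpos _ _ h1 h2 fun h => ?_
    have h3 : (1 - t) * a = 0 := by linarith
    have h4 : t * d = 0 := by linarith
    have h5 : t = 0 := by simpa [hd.ne'] using h4
    simp [h5, ha.ne'] at h3
  set u := tangentPart Λ v w with hu
  have hvu : pointForm Λ v u = 0 := pointForm_tangentPart hv w
  have huu : pointForm Λ u u = 1 - genCos Λ l ^ 2 := by
    have e1 : u = w + (-pointForm Λ v w) • v := by rw [hu, tangentPart]; module
    nth_rewrite 2 [e1]
    rw [pointForm_add_right, pointForm_smul_right, pointForm_comm Λ u v, hvu, pointForm_comm Λ u w,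
      e1, pointForm_add_right, pointForm_smul_right, hw, pointForm_comm Λ w v, hC]
    ring
  have hc : (fun t : ℝ => unitLift Λ ((1 - t) • a • v + t • d • w)) = fun t =>
      (((1 - t) * a + t * d * genCos Λ l) / √(q t)) • v + (t * d / √(q t)) • u := by
    funext t
    rw [unitLift, hqe, hC, hu, tangentPart]
    module
  have hspeed : ∀ t ∈ Set.Icc (0 : ℝ) 1,
      √|ambientForm Λ (deriv (fun t : ℝ => unitLift Λ ((1 - t) • a • v + t • d • w)) t)
        (deriv (fun t : ℝ => unitLift Λ ((1 - t) • a • v + t • d • w)) t)| =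
      a * d * genSin Λ l / q t := by
    intro t ht
    have hqt := hqpos t ht
    have hr : √(q t) ≠ 0 := (Real.sqrt_pos.2 hqt).ne'
    have hr2 : √(q t) ^ 2 = q t := Real.sq_sqrt hqt.le
    set q' : ℝ := 2 * ((1 - t) * a) * (-a) + 2 * genCos Λ l * ((-a) * (t * d) + (1 - t) * a * d)
      + 2 * (t * d) * d with hq'
    have d1 : HasDerivAt (fun t : ℝ => (1 - t) * a) (-a) t := by
      simpa using ((hasDerivAt_id t).const_sub 1).mul_const a
    have d2 : HasDerivAt (fun t : ℝ => t * d) d t := by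
      simpa using (hasDerivAt_id t).mul_const d
    have d3 : HasDerivAt q q' t := by
      have := ((d1.pow 2).add (((d1.mul d2).const_mul 2).mul_const (genCos Λ l))).add (d2.pow 2)
      refine (this.congr_deriv ?_).congr_of_eventuallyEq (Filter.Eventually.of_forall fun s => ?_)
      · simp only [hq']
        push_cast
        ring
      · simp only [hq, Pi.add_apply, Pi.pow_apply, Pi.mul_apply]
        ring
    have d4 := d3.sqrt hqt.ne'
    have d5 := (d1.add (d2.mul_const (genCos Λ l))).div d4 hr
    have d6 := d2.div d4 hr
    set A := ((1 - t) * a + t * d * genCos Λ l) / √(q t) with hA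
    set B := t * d / √(q t) with hB
    have d7 := (d5.smul_const v).add (d6.smul_const u)
    set A' := ((-a + d * genCos Λ l) * √(q t) -
      ((1 - t) * a + t * d * genCos Λ l) * (q' / (2 * √(q t)))) / √(q t) ^ 2 with hA'
    set B' := (d * √(q t) - t * d * (q' / (2 * √(q t)))) / √(q t) ^ 2 with hB'
    have d8 : HasDerivAt (fun t : ℝ => unitLift Λ ((1 - t) • a • v + t • d • w))
        (A' • v + B' • u) t := by
      rw [hc]
      exact d7
    rw [d8.deriv]
    have hunit : pointForm Λ (A • v + B • u) (A • v + B • u) = 1 := by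
      rw [pointForm_combination, hv, hvu, huu, hA, hB]
      field_simp
      rw [hr2]
      simp only [hq]
      ring
    have horth : pointForm Λ (A • v + B • u) (A' • v + B' • u) = 0 := by
      rw [pointForm_combination, hv, hvu, huu, hA, hB, hA', hB']
      field_simp
      rw [hr2]
      simp only [hq, hq']
      ring
    have hW : A * B' - B * A' = a * d / q t := by
      have e : a * d / q t = a * d / √(q t) ^ 2 := by rw [hr2]
      rw [e, hA, hB, hA', hB']
      field_simp
      ring
    rw [ambientForm_of_tangent hv hvu hunit horth, hW, ← hS]
    have e : (a * d / q t) ^ 2 * genSin Λ l ^ 2 = (a * d * genSin Λ l / q t) ^ 2 := by ring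
    rw [e, abs_of_nonneg (sq_nonneg _), Real.sqrt_sq]
    have := hl.genSin_pos
    positivity
  rw [segmentLength]
  rw [← integral_segment hl ha hd hqpos]
  refine intervalIntegral.integral_congr fun t ht => ?_
  rw [Set.uIcc_of_le zero_le_one] at ht
  exact hspeed t ht

/-! ### The edge lengths of a lightlike tetrahedron -/

theorem genDist_spec_of_tetrahedron {Λ : SignType} {v : Fin 4 → R4}
    (hv : IsLightlikeTetrahedron Λ v) (h1 : ∀ i, pointForm Λ (v i) (v i) = 1) {i j : Fin 4}
    (hij : i ≠ j) : IsGenAngle Λ (genDist Λ (v i) (v j)) ∧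
      genCos Λ (genDist Λ (v i) (v j)) = pointForm Λ (v i) (v j) ∧
      genSin Λ (genDist Λ (v i) (v j)) ^ 2 = vertexForm Λ v i j j := by
  obtain ⟨k, m, hik, him, hjk, hjm, hkm⟩ :
      ∃ k m : Fin 4, i ≠ k ∧ i ≠ m ∧ j ≠ k ∧ j ≠ m ∧ k ≠ m := by decide +revert
  refine genDist_spec (h1 i) (h1 j) ?_ (hv.signs h1 hij hik him hjk hjm hkm).1
  -- The form at `v i + v j` is 2 + 2⟨v i, v j⟩, whose positivity excludes the antipodal side.
  have h := hv.pointForm_segment_pos hij zero_le_one zero_le_one (by norm_num)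
  rw [pointForm_combination, h1, h1] at h
  linarith

/-- The cosine of each face angle is one of the signs of `signs`. The triangle relations of
`genDist_triangle` feed these signs into the combinatorial lemma. -/
theorem IsLightlikeTetrahedron.exists_lengths {Λ : SignType} {v : Fin 4 → R4}
    (hv : IsLightlikeTetrahedron Λ v) (h1 : ∀ i, pointForm Λ (v i) (v i) = 1) :
    ∃ e : Equiv.Perm (Fin 4),
      genDist Λ (v (e 0)) (v (e 3)) = genDist Λ (v (e 1)) (v (e 2)) ∧
      genDist Λ (v (e 1)) (v (e 3)) = genDist Λ (v (e 0)) (v (e 2)) ∧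
      genDist Λ (v (e 2)) (v (e 3)) = genDist Λ (v (e 0)) (v (e 1)) ∧
      genDist Λ (v (e 0)) (v (e 1)) =
        genDist Λ (v (e 0)) (v (e 3)) + genDist Λ (v (e 0)) (v (e 2)) := by
  set s : Fin 4 → Fin 4 → Fin 4 → ℝ := fun i j k =>
    vertexForm Λ v i j k / (√(vertexForm Λ v i j j) * √(vertexForm Λ v i k k)) with hs
  have fourth : ∀ i j k : Fin 4, i ≠ j → i ≠ k → j ≠ k → ∃ m, i ≠ m ∧ j ≠ m ∧ k ≠ m := by decide
  have hpos : ∀ i j, i ≠ j → 0 < vertexForm Λ v i j j := by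
    intro i j hij
    rw [← (genDist_spec_of_tetrahedron hv h1 hij).2.2]
    exact pow_pos (genDist_spec_of_tetrahedron hv h1 hij).1.genSin_pos 2
  have hsval : ∀ i j k (σ : ℝ), i ≠ j → i ≠ k →
      vertexForm Λ v i j k = σ * √(vertexForm Λ v i j j) * √(vertexForm Λ v i k k) →
        s i j k = σ := by
    intro i j k σ hij hik h
    have e1 := (Real.sqrt_pos.2 (hpos i j hij)).ne'
    have e2 := (Real.sqrt_pos.2 (hpos i k hik)).ne'
    simp only [hs, h]
    field_simp
  have hs1 : ∀ i j k, i ≠ j → i ≠ k → j ≠ k → s i j k = 1 ∨ s i j k = -1 := by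
    intro i j k hij hik hjk
    obtain ⟨m, him, hjm, hkm⟩ := fourth i j k hij hik hjk
    obtain ⟨-, -, -, s₁, -, -, e1, -, -, -, e2, -, -⟩ := hv.signs h1 hij hik him hjk hjm hkm
    rw [hsval i j k s₁ hij hik e2]
    exact sq_eq_one_iff.1 e1
  have htri : ∀ i j k, i ≠ j → i ≠ k → j ≠ k →
      (s i j k = 1 → genDist Λ (v j) (v k) = |genDist Λ (v i) (v j) - genDist Λ (v i) (v k)|) ∧
      (s i j k = -1 → genDist Λ (v j) (v k) = genDist Λ (v i) (v j) + genDist Λ (v i) (v k) ∨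
        (Λ = 1 ∧ genDist Λ (v i) (v j) + genDist Λ (v i) (v k) + genDist Λ (v j) (v k)
          = 2 * Real.pi)) := by
    intro i j k hij hik hjk
    have eij := genDist_spec_of_tetrahedron hv h1 hij
    have eik := genDist_spec_of_tetrahedron hv h1 hik
    have ejk := genDist_spec_of_tetrahedron hv h1 hjk
    refine genDist_triangle (h1 i) eij.1 eik.1 ejk.1 eij.2.1 eik.2.1 ejk.2.1 eij.2.2 eik.2.2
      ejk.2.2 ?_
    have h2 := (Real.sqrt_pos.2 (hpos i j hij)).ne'
    have h3 := (Real.sqrt_pos.2 (hpos i k hik)).ne'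
    rw [← Real.sqrt_sq eij.1.genSin_pos.le, ← Real.sqrt_sq eik.1.genSin_pos.le, eij.2.2, eik.2.2]
    simp only [hs]
    rw [mul_assoc, div_mul_cancel₀ _ (mul_ne_zero h2 h3)]
    rfl
  refine exists_perm_of_triangles (l := fun i j => genDist Λ (v i) (v j)) (s := s)
    (fun i j => genDist_comm _ _ _) ?_ ?_ hs1 ?_ (fun i j k hij hik hjk => (htri i j k hij hik hjk).1)
    ?_
  · intro i j k
    simp only [hs]
    rw [vertexForm_comm, mul_comm]
  · intro i j hij
    exact (genDist_spec_of_tetrahedron hv h1 hij).1.1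
  · intro i j k m hij hik him hjk hjm hkm
    obtain ⟨-, -, -, s₁, s₂, s₃, -, -, -, e, e1, e2, e3⟩ := hv.signs h1 hij hik him hjk hjm hkm
    rw [hsval i j k s₁ hij hik e1, hsval i j m s₂ hij him e2, hsval i k m s₃ hik him e3, e]
  · intro i j k hij hik hjk h
    rcases (htri i j k hij hik hjk).2 h with h2 | ⟨h2, h3⟩
    · exact Or.inl h2
    · exact Or.inr ⟨h3, (genDist_spec_of_tetrahedron hv h1 hij).1.2 h2,
        (genDist_spec_of_tetrahedron hv h1 hik).1.2 h2,
        (genDist_spec_of_tetrahedron hv h1 hjk).1.2 h2⟩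

/-! ### The Gram determinant of the vertices -/

theorem Matrix.det_fin_four {R : Type*} [CommRing R] (M : Matrix (Fin 4) (Fin 4) R) : M.det =
    M 0 0 * (M 1 1 * (M 2 2 * M 3 3 - M 2 3 * M 3 2) - M 1 2 * (M 2 1 * M 3 3 - M 2 3 * M 3 1) +
      M 1 3 * (M 2 1 * M 3 2 - M 2 2 * M 3 1)) -
    M 0 1 * (M 1 0 * (M 2 2 * M 3 3 - M 2 3 * M 3 2) - M 1 2 * (M 2 0 * M 3 3 - M 2 3 * M 3 0) +
      M 1 3 * (M 2 0 * M 3 2 - M 2 2 * M 3 0)) +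
    M 0 2 * (M 1 0 * (M 2 1 * M 3 3 - M 2 3 * M 3 1) - M 1 1 * (M 2 0 * M 3 3 - M 2 3 * M 3 0) +
      M 1 3 * (M 2 0 * M 3 1 - M 2 1 * M 3 0)) -
    M 0 3 * (M 1 0 * (M 2 1 * M 3 2 - M 2 2 * M 3 1) - M 1 1 * (M 2 0 * M 3 2 - M 2 2 * M 3 0) +
      M 1 2 * (M 2 0 * M 3 1 - M 2 1 * M 3 0)) := by
  rw [Matrix.det_succ_row_zero]
  simp [Fin.sum_univ_succ, Matrix.det_fin_three, Matrix.submatrix_apply, Fin.succAbove]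
  ring

/-- The right side is minus the Gram determinant of the tangent vectors. For Λ ≠ 0 the Gram matrix
of all four vectors splits off the entry 1 of `v`, and the diagonal matrix of the form has
determinant -Λ³. For Λ = 0 the tangent vectors have vanishing second coordinate and `v 1` is ±1, so
the determinant reduces to a 3 × 3 minor. -/
theorem det_sq_eq_of_tangent {Λ : SignType} {v w₁ w₂ w₃ : R4} (hv : pointForm Λ v v = 1)
    (h₁ : pointForm Λ v w₁ = 0) (h₂ : pointForm Λ v w₂ = 0) (h₃ : pointForm Λ v w₃ = 0) :
    (Matrix.of ![v, w₁, w₂, w₃]).det ^ 2 =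
      -(ambientForm Λ w₁ w₁ * ambientForm Λ w₂ w₂ * ambientForm Λ w₃ w₃ +
        2 * (ambientForm Λ w₁ w₂ * ambientForm Λ w₁ w₃ * ambientForm Λ w₂ w₃) -
        ambientForm Λ w₁ w₁ * ambientForm Λ w₂ w₃ ^ 2 -
        ambientForm Λ w₂ w₂ * ambientForm Λ w₁ w₃ ^ 2 -
        ambientForm Λ w₃ w₃ * ambientForm Λ w₁ w₂ ^ 2) := by
  by_cases h : Λ = 0
  · subst h
    simp only [pointForm_zero_eq] at hv h₁ h₂ h₃
    have hv1 : v 1 ≠ 0 := fun h0 => by simp [h0] at hv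
    have e₁ : w₁ 1 = 0 := (mul_eq_zero.1 h₁).resolve_left hv1
    have e₂ : w₂ 1 = 0 := (mul_eq_zero.1 h₂).resolve_left hv1
    have e₃ : w₃ 1 = 0 := (mul_eq_zero.1 h₃).resolve_left hv1
    rw [Matrix.det_fin_four]
    simp only [Matrix.of_apply, Matrix.cons_val, ambientForm, e₁, e₂, e₃]
    linear_combination (w₁ 0 * (w₂ 2 * w₃ 3 - w₂ 3 * w₃ 2) - w₁ 2 * (w₂ 0 * w₃ 3 - w₂ 3 * w₃ 0) +
      w₁ 3 * (w₂ 0 * w₃ 2 - w₂ 2 * w₃ 0)) ^ 2 * hv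
  · obtain ⟨M, hM⟩ : ∃ M : Matrix (Fin 4) (Fin 4) ℝ, Matrix.of ![v, w₁, w₂, w₃] = M := ⟨_, rfl⟩
    rw [hM]
    have hG : M * Matrix.diagonal ![-(Λ : ℝ), 1, Λ, Λ] * M.transpose =
        Matrix.of fun i j => pointForm Λ (M i) (M j) := by
      ext i j
      rw [Matrix.mul_apply]
      simp only [Matrix.mul_diagonal, Fin.sum_univ_four, Matrix.transpose_apply, Matrix.of_apply,
        pointForm, Matrix.cons_val]
      ring
    have hdet := (congrArg Matrix.det hG).trans (Matrix.det_fin_four _)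
    rw [Matrix.det_mul, Matrix.det_mul, Matrix.det_transpose, Matrix.det_diagonal] at hdet
    have m0 : M 0 = v := by rw [← hM]; rfl
    have m1 : M 1 = w₁ := by rw [← hM]; rfl
    have m2 : M 2 = w₂ := by rw [← hM]; rfl
    have m3 : M 3 = w₃ := by rw [← hM]; rfl
    simp only [Fin.prod_univ_four, Matrix.of_apply, Matrix.cons_val, m0, m1, m2, m3, hv, h₁, h₂, h₃,
      pointForm_comm Λ w₁ v, pointForm_comm Λ w₂ v, pointForm_comm Λ w₃ v,
      pointForm_comm Λ w₂ w₁, pointForm_comm Λ w₃ w₁, pointForm_comm Λ w₃ w₂] at hdet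
    simp only [ambientForm_eq_mul_pointForm h]
    have hΛ := sq_cast_of_ne_zero h
    generalize (Λ : ℝ) = L at *
    have hL4 : L ^ 4 = 1 := by rw [show L ^ 4 = (L ^ 2) ^ 2 by ring, hΛ, one_pow]
    linear_combination (-M.det ^ 2) * hL4 + (-L) * hdet +
      (L * (pointForm Λ w₁ w₁ * pointForm Λ w₂ w₂ * pointForm Λ w₃ w₃ +
        2 * (pointForm Λ w₁ w₂ * pointForm Λ w₁ w₃ * pointForm Λ w₂ w₃) -
        pointForm Λ w₁ w₁ * pointForm Λ w₂ w₃ ^ 2 -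
        pointForm Λ w₂ w₂ * pointForm Λ w₁ w₃ ^ 2 -
        pointForm Λ w₃ w₃ * pointForm Λ w₁ w₂ ^ 2)) * hΛ

/-- The volume of the parallelepiped spanned by the normalized vertices. -/
theorem IsLightlikeTetrahedron.abs_det {Λ : SignType} {v : Fin 4 → R4}
    (hv : IsLightlikeTetrahedron Λ v) (h1 : ∀ i, pointForm Λ (v i) (v i) = 1) :
    |(Matrix.of v).det| = 2 * genSin Λ (genDist Λ (v 0) (v 1)) *
      genSin Λ (genDist Λ (v 0) (v 2)) * genSin Λ (genDist Λ (v 0) (v 3)) := by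
  have e1 := genDist_spec_of_tetrahedron hv h1 (show (0 : Fin 4) ≠ 1 by decide)
  have e2 := genDist_spec_of_tetrahedron hv h1 (show (0 : Fin 4) ≠ 2 by decide)
  have e3 := genDist_spec_of_tetrahedron hv h1 (show (0 : Fin 4) ≠ 3 by decide)
  have p1 := e1.1.genSin_pos
  have p2 := e2.1.genSin_pos
  have p3 := e3.1.genSin_pos
  obtain ⟨q1, q2, q3, s, t, u, hs, ht, hu, hsum, h12, h13, h23⟩ := hv.signs_zero (h1 0)
  have hdet : (Matrix.of v).det = (Matrix.of ![v 0, tangentPart Λ (v 0) (v 1),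
      tangentPart Λ (v 0) (v 2), tangentPart Λ (v 0) (v 3)]).det := by
    rw [Matrix.det_fin_four, Matrix.det_fin_four]
    simp only [Matrix.of_apply, Matrix.cons_val, tangentPart, Pi.sub_apply, Pi.smul_apply,
      smul_eq_mul]
    ring
  have hsq := det_sq_eq_of_tangent (h1 0) (pointForm_tangentPart (h1 0) (v 1))
    (pointForm_tangentPart (h1 0) (v 2)) (pointForm_tangentPart (h1 0) (v 3))
  rw [← hdet] at hsq
  change _ = -(vertexForm Λ v 0 1 1 * vertexForm Λ v 0 2 2 * vertexForm Λ v 0 3 3 +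
    2 * (vertexForm Λ v 0 1 2 * vertexForm Λ v 0 1 3 * vertexForm Λ v 0 2 3) -
    vertexForm Λ v 0 1 1 * vertexForm Λ v 0 2 3 ^ 2 -
    vertexForm Λ v 0 2 2 * vertexForm Λ v 0 1 3 ^ 2 -
    vertexForm Λ v 0 3 3 * vertexForm Λ v 0 1 2 ^ 2) at hsq
  rw [h12, h13, h23, ← e1.2.2, ← e2.2.2, ← e3.2.2, Real.sqrt_sq p1.le, Real.sqrt_sq p2.le,
    Real.sqrt_sq p3.le] at hsq
  -- Exactly one sign is negative. The Gram determinant x²y²z²(1 + 2stu - s² - t² - u²) therefore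
  -- equals -4x²y²z².
  have hstu : s * t * u = -1 := by
    rcases sq_eq_one_iff.1 hs with rfl | rfl <;> rcases sq_eq_one_iff.1 ht with rfl | rfl <;>
      rcases sq_eq_one_iff.1 hu with rfl | rfl <;>
      first
      | (norm_num; done)
      | norm_num at hsum
  rw [← abs_of_pos (show 0 < 2 * genSin Λ (genDist Λ (v 0) (v 1)) *
      genSin Λ (genDist Λ (v 0) (v 2)) * genSin Λ (genDist Λ (v 0) (v 3)) by positivity)]
  refine (sq_eq_sq_iff_abs_eq_abs _ _).1 ?_
  rw [hsq]
  generalize genSin Λ (genDist Λ (v 0) (v 1)) = x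
  generalize genSin Λ (genDist Λ (v 0) (v 2)) = y
  generalize genSin Λ (genDist Λ (v 0) (v 3)) = z
  linear_combination (x ^ 2 * y ^ 2 * z ^ 2) * (-2 * hstu + hs + ht + hu)

/-! ### The volume density in the affine chart -/

theorem hasDerivAt_unitLift_line {Λ : SignType} {c E : R4} (hc : 0 < pointForm Λ c c) :
    HasDerivAt (fun t : ℝ => unitLift Λ (c + t • E)) ((√(pointForm Λ c c))⁻¹ •
      (E + (-(pointForm Λ c E / pointForm Λ c c)) • c)) 0 := by
  have hq : ∀ t : ℝ, pointForm Λ (c + t • E) (c + t • E) =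
      pointForm Λ c c + t * (2 * pointForm Λ c E) + t ^ 2 * pointForm Λ E E := fun t => by
    have := pointForm_combination Λ 1 t 1 t c E
    rw [one_smul] at this
    rw [this]
    ring
  have d1 : HasDerivAt (fun t : ℝ => pointForm Λ (c + t • E) (c + t • E))
      (2 * pointForm Λ c E) 0 := by
    simp only [hq]
    have := (((hasDerivAt_id (0 : ℝ)).mul_const (2 * pointForm Λ c E)).const_add
      (pointForm Λ c c)).add (((hasDerivAt_id (0 : ℝ)).pow 2).mul_const (pointForm Λ E E))
    refine this.congr_deriv ?_
    simp
  have h0 : pointForm Λ (c + (0 : ℝ) • E) (c + (0 : ℝ) • E) = pointForm Λ c c := by simp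
  have d2 := (d1.sqrt (by rw [h0]; exact hc.ne')).inv
    (by rw [h0]; exact (Real.sqrt_pos.2 hc).ne')
  have d3 : HasDerivAt (fun t : ℝ => c + t • E) E 0 := by
    simpa using ((hasDerivAt_id (0 : ℝ)).smul_const E).const_add c
  have hr : √(pointForm Λ c c) ≠ 0 := (Real.sqrt_pos.2 hc).ne'
  have hr2 : √(pointForm Λ c c) ^ 2 = pointForm Λ c c := Real.sq_sqrt hc.le
  refine (d2.smul d3).congr_deriv ?_
  simp only [Pi.inv_apply, zero_smul, add_zero]
  rw [smul_add, smul_smul]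
  congr 2
  rw [hr2]
  field_simp

theorem chartVec_add_smul_single (u : Fin 3 → ℝ) (t : ℝ) (i : Fin 3) :
    chartVec (u + t • Pi.single i 1) =
      chartVec u + t • (Pi.single ((1 : Fin 4).succAbove i) 1 : R4) := by
  ext j
  fin_cases i <;> fin_cases j <;> simp [chartVec, Fin.succAbove]

theorem differentiableAt_unitLift_chartVec {Λ : SignType} {u : Fin 3 → ℝ}
    (hu : 0 < pointForm Λ (chartVec u) (chartVec u)) :
    DifferentiableAt ℝ (fun u' => unitLift Λ (chartVec u')) u := by
  have h1 : Differentiable ℝ chartVec := by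
    refine differentiable_pi.2 fun i => ?_
    fin_cases i <;> simp only [chartVec] <;> simp <;> fun_prop
  have h2 : Differentiable ℝ fun u' => pointForm Λ (chartVec u') (chartVec u') := by
    simp only [pointForm]
    have h3 := differentiable_pi.1 h1
    fun_prop
  exact ((h2 u).sqrt hu.ne').inv (Real.sqrt_pos.2 hu).ne' |>.smul (h1 u)

theorem metricMatrix_apply {Λ : SignType} {u : Fin 3 → ℝ}
    (hu : 0 < pointForm Λ (chartVec u) (chartVec u)) (i j : Fin 3) :
    metricMatrix Λ u i j = (pointForm Λ (chartVec u) (chartVec u))⁻¹ * ambientForm Λ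
      ((Pi.single ((1 : Fin 4).succAbove i) 1 : R4) + (-(pointForm Λ (chartVec u)
        (Pi.single ((1 : Fin 4).succAbove i) 1) / pointForm Λ (chartVec u) (chartVec u))) • chartVec u)
      ((Pi.single ((1 : Fin 4).succAbove j) 1 : R4) + (-(pointForm Λ (chartVec u)
        (Pi.single ((1 : Fin 4).succAbove j) 1) / pointForm Λ (chartVec u) (chartVec u))) • chartVec u)
      := by
  have hf : ∀ i : Fin 3, fderiv ℝ (fun u' => unitLift Λ (chartVec u')) u (Pi.single i 1) =
      (√(pointForm Λ (chartVec u) (chartVec u)))⁻¹ • ((Pi.single ((1 : Fin 4).succAbove i) 1 : R4) +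
        (-(pointForm Λ (chartVec u) (Pi.single ((1 : Fin 4).succAbove i) 1) /
          pointForm Λ (chartVec u) (chartVec u))) • chartVec u) := by
    intro i
    rw [← (differentiableAt_unitLift_chartVec hu).lineDeriv_eq_fderiv]
    refine HasLineDerivAt.lineDeriv ?_
    rw [HasLineDerivAt]
    simp only [chartVec_add_smul_single]
    exact hasDerivAt_unitLift_line hu
  simp only [metricMatrix, Matrix.of_apply, hf]
  rw [ambientForm_smul_right, ambientForm_comm, ambientForm_smul_right, ← mul_assoc, ← mul_inv,
    Real.mul_self_sqrt hu.le, ambientForm_comm]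

/-- The determinant is -q⁻⁴ by direct computation. The density q⁻² is homogeneous of degree -4 on
ℝ⁴, the degree needed to express projective volume through cones. -/
theorem sqrt_abs_det_metricMatrix {Λ : SignType} {u : Fin 3 → ℝ}
    (hu : 0 < pointForm Λ (chartVec u) (chartVec u)) :
    √|(metricMatrix Λ u).det| = (pointForm Λ (chartVec u) (chartVec u) ^ 2)⁻¹ := by
  have hdet : (metricMatrix Λ u).det = -((pointForm Λ (chartVec u) (chartVec u) ^ 2)⁻¹) ^ 2 := by
    rw [Matrix.det_fin_three]
    simp only [metricMatrix_apply hu]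
    have hq : pointForm Λ (chartVec u) (chartVec u) =
        1 + Λ * (-(u 0 ^ 2) + u 1 ^ 2 + u 2 ^ 2) := by
      simp only [pointForm, chartVec, Matrix.cons_val]
      ring
    have hq0 := hu.ne'
    generalize hQ : pointForm Λ (chartVec u) (chartVec u) = Q at *
    simp [pointForm, ambientForm, Fin.succAbove, chartVec]
    rcases SignType.trichotomy Λ with rfl | rfl | rfl
    · simp only [SignType.coe_neg_one] at hq ⊢
      field_simp
      subst hq
      ring
    · simp only [SignType.coe_zero] at hq ⊢
      rw [hq]
      simp
    · simp only [SignType.coe_one] at hq ⊢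
      field_simp
      subst hq
      ring
  rw [hdet, abs_neg, abs_of_nonneg (sq_nonneg _), Real.sqrt_sq (by positivity)]

/-! ### Volumes of cones -/

theorem measurable_chartVec : Measurable chartVec := by
  refine measurable_pi_iff.2 fun i => ?_
  fin_cases i <;> simp [chartVec] <;> fun_prop

/-- These are projective polar coordinates x = t (u₁, 1, u₂, u₃). For fixed t ≠ 0 the three
remaining coordinates are dilated by t, which gives the factor |t|³. -/
theorem lintegral_R4_eq (f : R4 → ENNReal) (hf : Measurable f) :
    ∫⁻ x, f x = ∫⁻ u : Fin 3 → ℝ, ∫⁻ t : ℝ, ENNReal.ofReal (|t| ^ 3) * f (t • chartVec u) := by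
  have e := (volume_preserving_piFinSuccAbove (fun _ : Fin 4 => ℝ) 1).symm
  have hm : Measurable (fun p : ℝ × (Fin 3 → ℝ) =>
      f ((MeasurableEquiv.piFinSuccAbove (fun _ : Fin 4 => ℝ) 1).symm p)) :=
    hf.comp (MeasurableEquiv.measurable _)
  rw [← e.lintegral_comp_emb (MeasurableEquiv.measurableEmbedding _), Measure.volume_eq_prod,
    lintegral_prod _ hm.aemeasurable]
  have hswap : ∫⁻ u : Fin 3 → ℝ, ∫⁻ t : ℝ, ENNReal.ofReal (|t| ^ 3) * f (t • chartVec u) =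
      ∫⁻ t : ℝ, ∫⁻ u : Fin 3 → ℝ, ENNReal.ofReal (|t| ^ 3) * f (t • chartVec u) := by
    refine lintegral_lintegral_swap (Measurable.aemeasurable ?_)
    refine Measurable.mul (by fun_prop) (hf.comp ?_)
    exact measurable_snd.smul (measurable_chartVec.comp measurable_fst)
  rw [hswap]
  have hae : ∀ᵐ t : ℝ, t ≠ 0 := by simp [ae_iff]
  refine lintegral_congr_ae (hae.mono fun t ht => ?_)
  have hg : Measurable fun w : Fin 3 → ℝ =>
      f ((MeasurableEquiv.piFinSuccAbove (fun _ : Fin 4 => ℝ) 1).symm (t, w)) :=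
    hm.comp (measurable_const.prodMk measurable_id)
  have hmap := Measure.map_addHaar_smul (volume : Measure (Fin 3 → ℝ)) ht
  have h1 := lintegral_map (μ := volume) hg (measurable_const_smul (α := Fin 3 → ℝ) t)
  rw [hmap, lintegral_smul_measure] at h1
  have h2 : ∀ u : Fin 3 → ℝ,
      (MeasurableEquiv.piFinSuccAbove (fun _ : Fin 4 => ℝ) 1).symm (t, t • u) = t • chartVec u := by
    intro u
    ext j
    fin_cases j <;> simp [MeasurableEquiv.piFinSuccAbove, chartVec, Fin.insertNthEquiv,
      Fin.insertNth, Fin.succAboveCases]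
  simp only [h2, Module.finrank_fin_fun] at h1
  simp only
  rw [lintegral_const_mul (f := fun u => f (t • chartVec u)) _
    (hf.comp ((measurable_const_smul t).comp measurable_chartVec)), ← h1, smul_eq_mul,
    ← mul_assoc, ← ENNReal.ofReal_mul (by positivity), abs_inv, abs_pow,
    mul_inv_cancel₀ (by positivity), ENNReal.ofReal_one, one_mul]

theorem lintegral_Ioo_cube {r : ℝ} (hr : 0 ≤ r) :
    ∫⁻ t in Set.Ioo 0 r, ENNReal.ofReal (t ^ 3) = ENNReal.ofReal (r ^ 4 / 4) := by
  rw [lintegral_Ioo_ofReal_deriv (F := fun t => t ^ 4 / 4) hr (by fun_prop)]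
  · simp
  · intro x _
    refine ((hasDerivAt_pow 4 x).div_const 4).congr_deriv ?_
    norm_num
  · intro x hx
    exact pow_nonneg hx.1.le 3

/-- On the ray through x the set q < 1 is t < q(x)^(-1/2), and the integral of t³ up to there is
q(x)⁻²/4. Since K contains no opposite nonzero vectors, each line of the chart contributes a single
ray. The right side changes by a determinant under linear maps, which makes coordinates adapted to
the vertices available. -/
theorem lintegral_chart_eq_volume_cone {K : Set R4} {q : R4 → ℝ} (hK : MeasurableSet K)
    (hq : Measurable q) (hKs : ∀ x ∈ K, ∀ t : ℝ, 0 < t → t • x ∈ K)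
    (hK0 : ∀ x ∈ K, x ≠ 0 → -x ∉ K) (hqs : ∀ (t : ℝ) x, q (t • x) = t ^ 2 * q x)
    (hqpos : ∀ x ∈ K, x ≠ 0 → 0 < q x) :
    ∫⁻ u in {u | chartVec u ∈ K ∨ -chartVec u ∈ K}, ENNReal.ofReal ((q (chartVec u) ^ 2)⁻¹) =
      4 * volume {x | x ∈ K ∧ q x < 1} := by
  have hA : MeasurableSet {u | chartVec u ∈ K ∨ -chartVec u ∈ K} :=
    (measurable_chartVec hK).union (measurable_chartVec.neg hK)
  have hE : MeasurableSet {x | x ∈ K ∧ q x < 1} := hK.inter (hq measurableSet_Iio)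
  have hcone : ∀ x, x ∈ K → ∫⁻ t : ℝ, ENNReal.ofReal (|t| ^ 3) *
      {x | x ∈ K ∧ q x < 1}.indicator 1 (t • x) = ENNReal.ofReal ((q x ^ 2)⁻¹ / 4) ∨ x = 0 := by
    intro x hx
    by_cases hx0 : x = 0
    · exact Or.inr hx0
    left
    have hqx := hqpos x hx hx0
    have hr : 0 < √(q x)⁻¹ := Real.sqrt_pos.2 (by positivity)
    have hr2 : √(q x)⁻¹ ^ 2 = (q x)⁻¹ := Real.sq_sqrt (by positivity)
    have h1 : ∫⁻ t : ℝ, ENNReal.ofReal (|t| ^ 3) * {x | x ∈ K ∧ q x < 1}.indicator 1 (t • x) =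
        ∫⁻ t : ℝ, (Set.Ioo 0 √(q x)⁻¹).indicator (fun t => ENNReal.ofReal (t ^ 3)) t := by
      have hae : ∀ᵐ t : ℝ, t ≠ 0 := by simp [ae_iff]
      refine lintegral_congr_ae (hae.mono fun t ht => ?_)
      by_cases htm : t ∈ Set.Ioo 0 √(q x)⁻¹
      · have : t • x ∈ {x | x ∈ K ∧ q x < 1} := by
          refine ⟨hKs x hx t htm.1, ?_⟩
          rw [hqs]
          have h2 : t ^ 2 < (q x)⁻¹ := by
            rw [← hr2]
            exact pow_lt_pow_left₀ htm.2 htm.1.le two_ne_zero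
          calc t ^ 2 * q x < (q x)⁻¹ * q x := by gcongr
            _ = 1 := inv_mul_cancel₀ hqx.ne'
        simp only [Set.indicator_of_mem this, Set.indicator_of_mem htm, Pi.one_apply, mul_one,
          abs_of_pos htm.1]
      · have : t • x ∉ {x | x ∈ K ∧ q x < 1} := by
          rintro ⟨h3, h4⟩
          rcases lt_or_gt_of_ne ht with h5 | h5
          · refine hK0 x hx hx0 ?_
            have := hKs _ h3 (-t)⁻¹ (inv_pos.2 (neg_pos.2 h5))
            rwa [smul_smul, inv_neg, neg_mul, inv_mul_cancel₀ ht, neg_one_smul] at this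
          · refine htm ⟨h5, ?_⟩
            rw [hqs] at h4
            have h6 : t ^ 2 < √(q x)⁻¹ ^ 2 := by
              rw [hr2]
              exact (lt_div_iff₀ hqx).2 h4 |>.trans_eq (one_div _)
            exact lt_of_pow_lt_pow_left₀ 2 hr.le h6
        simp only [Set.indicator_of_notMem this, Set.indicator_of_notMem htm, mul_zero]
    rw [h1, lintegral_indicator measurableSet_Ioo, lintegral_Ioo_cube hr.le]
    congr 2
    rw [show √(q x)⁻¹ ^ 4 = (√(q x)⁻¹ ^ 2) ^ 2 by ring, hr2, inv_pow]
  have hinner : ∀ u, ∫⁻ t : ℝ, ENNReal.ofReal (|t| ^ 3) *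
      {x | x ∈ K ∧ q x < 1}.indicator 1 (t • chartVec u) =
      {u | chartVec u ∈ K ∨ -chartVec u ∈ K}.indicator
        (fun u => ENNReal.ofReal ((q (chartVec u) ^ 2)⁻¹ / 4)) u := by
    intro u
    by_cases hu : u ∈ {u | chartVec u ∈ K ∨ -chartVec u ∈ K}
    · rw [Set.indicator_of_mem hu]
      rcases hu with hu | hu
      · exact (hcone _ hu).resolve_right (chartVec_ne_zero u)
      · have h2 := (hcone _ hu).resolve_right (neg_ne_zero.2 (chartVec_ne_zero u))
        have h3 : q (-chartVec u) = q (chartVec u) := by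
          rw [← neg_one_smul ℝ, hqs]
          norm_num
        rw [h3] at h2
        rw [← h2, ← (Measure.measurePreserving_neg (volume : Measure ℝ)).lintegral_comp_emb
          (MeasurableEquiv.neg ℝ).measurableEmbedding]
        simp only [abs_neg, neg_smul, smul_neg]
    · rw [Set.indicator_of_notMem hu]
      have hae : ∀ᵐ t : ℝ, t ≠ 0 := by simp [ae_iff]
      rw [← lintegral_zero]
      refine lintegral_congr_ae (hae.mono fun t ht => ?_)
      have : t • chartVec u ∉ {x | x ∈ K ∧ q x < 1} := by
        rintro ⟨h3, -⟩
        refine hu ?_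
        rcases lt_or_gt_of_ne ht with h5 | h5
        · right
          have := hKs _ h3 (-t)⁻¹ (inv_pos.2 (neg_pos.2 h5))
          rwa [smul_smul, inv_neg, neg_mul, inv_mul_cancel₀ ht, neg_one_smul] at this
        · left
          have := hKs _ h3 t⁻¹ (inv_pos.2 h5)
          rwa [smul_smul, inv_mul_cancel₀ ht, one_smul] at this
      simp only [Set.indicator_of_notMem this, mul_zero]
  have h4 : ∀ u, ENNReal.ofReal ((q (chartVec u) ^ 2)⁻¹) =
      4 * ENNReal.ofReal ((q (chartVec u) ^ 2)⁻¹ / 4) := by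
    intro u
    rw [show (4 : ENNReal) = ENNReal.ofReal 4 by simp, ← ENNReal.ofReal_mul (by norm_num)]
    congr 1
    ring
  simp only [h4]
  have h5 : Measurable fun u => ENNReal.ofReal ((q (chartVec u) ^ 2)⁻¹ / 4) :=
    ((((hq.comp measurable_chartVec).pow_const 2).inv).div_const 4).ennreal_ofReal
  rw [lintegral_const_mul _ h5, ← lintegral_indicator_one hE,
    lintegral_R4_eq _ (measurable_one.indicator hE)]
  simp only [hinner]
  rw [lintegral_indicator hA]

/-- The linear map with `e i ↦ v i`. -/
noncomputable def vertexMap (v : Fin 4 → R4) : R4 →ₗ[ℝ] R4 :=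
  Matrix.toLin' (Matrix.of v).transpose

theorem vertexMap_apply (v : Fin 4 → R4) (a : R4) : vertexMap v a = ∑ i, a i • v i := by
  ext j
  simp [vertexMap, Matrix.mulVec, dotProduct, mul_comm]

theorem mk_mem_geodesicSimplex_iff (v : Fin 4 → R4) {x : R4} (hx : x ≠ 0) :
    Projectivization.mk ℝ x hx ∈ geodesicSimplex v ↔
      x ∈ vertexMap v '' {a | ∀ i, 0 ≤ a i} ∨ -x ∈ vertexMap v '' {a | ∀ i, 0 ≤ a i} := by
  constructor
  · rintro ⟨a, ha, h, hp⟩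
    obtain ⟨c, hc⟩ := (Projectivization.mk_eq_mk_iff' ℝ _ _ _ _).1 hp
    rcases le_total 0 c with h0 | h0
    · refine Or.inl ⟨c • a, fun i => mul_nonneg h0 (ha i), ?_⟩
      rw [map_smul, vertexMap_apply, hc]
    · refine Or.inr ⟨(-c) • a, fun i => mul_nonneg (neg_nonneg.2 h0) (ha i), ?_⟩
      rw [map_smul, vertexMap_apply, neg_smul, hc]
  · rintro (⟨a, ha, h⟩ | ⟨a, ha, h⟩)
    · rw [vertexMap_apply] at h
      exact ⟨a, ha, by rwa [h], by simp only [h]⟩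
    · rw [vertexMap_apply] at h
      refine ⟨a, ha, by rwa [h, neg_ne_zero], ?_⟩
      rw [Projectivization.mk_eq_mk_iff']
      exact ⟨-1, by rw [h]; simp⟩

/-- The cone formula is applied twice, to the cone over Θ and to the positive orthant with the
pulled-back form; `vertexMap` carries one truncated cone to the other. The result is an integral
over barycentric coordinates in which the coefficient of `v 1` is 1. -/
theorem IsLightlikeTetrahedron.volX_eq {Λ : SignType} {v : Fin 4 → R4}
    (hv : IsLightlikeTetrahedron Λ v) : volX Λ (geodesicSimplex v) =
      ENNReal.ofReal |(Matrix.of v).det| * ∫⁻ u in {u : Fin 3 → ℝ | ∀ i, 0 ≤ u i},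
        ENNReal.ofReal ((pointForm Λ (vertexMap v (chartVec u)) (vertexMap v (chartVec u)) ^ 2)⁻¹)
      := by
  set O : Set R4 := {a | ∀ i, 0 ≤ a i} with hO
  have hOm : MeasurableSet O := by
    have : O = ⋂ i, {a : R4 | 0 ≤ a i} := by ext; simp [hO]
    rw [this]
    exact MeasurableSet.iInter fun i => measurableSet_le measurable_const (measurable_pi_apply i)
  have hlin : Continuous (vertexMap v) := (vertexMap v).continuous_of_finiteDimensional
  have hinj : Function.Injective (vertexMap v) := by
    rw [← LinearMap.ker_eq_bot, LinearMap.ker_eq_bot']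
    intro a ha
    rw [vertexMap_apply] at ha
    exact funext (Fintype.linearIndependent_iff.1 hv.nondegenerate a ha)
  have hKm : MeasurableSet (vertexMap v '' O) :=
    hOm.image_of_continuousOn_injOn hlin.continuousOn hinj.injOn
  have hpf : Measurable fun x => pointForm Λ x x := by
    simp only [pointForm]
    fun_prop
  have hpos : ∀ a ∈ O, a ≠ 0 → 0 < pointForm Λ (vertexMap v a) (vertexMap v a) := by
    intro a ha ha0
    rw [vertexMap_apply]
    exact hv.pointForm_pos ha ha0
  have hO0 : ∀ a ∈ O, a ≠ 0 → -a ∉ O := fun a ha ha0 hna => ha0 <| funext fun i =>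
    le_antisymm (neg_nonneg.1 (hna i)) (ha i)
  have hOs : ∀ a ∈ O, ∀ t : ℝ, 0 < t → t • a ∈ O := fun a ha t ht i => mul_nonneg ht.le (ha i)
  have h1 := lintegral_chart_eq_volume_cone hKm hpf
    (by
      rintro _ ⟨a, ha, rfl⟩ t ht
      exact ⟨t • a, hOs a ha t ht, map_smul _ _ _⟩)
    (by
      rintro _ ⟨a, ha, rfl⟩ h0 ⟨b, hb, hba⟩
      rw [← map_neg] at hba
      have := hinj hba
      subst this
      exact hO0 a ha (fun h => h0 (by rw [h, map_zero])) hb)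
    (fun t x => pointForm_smul_smul Λ t x)
    (by
      rintro _ ⟨a, ha, rfl⟩ h0
      exact hpos a ha fun h => h0 (by rw [h, map_zero]))
  have h2 := lintegral_chart_eq_volume_cone hOm (hpf.comp hlin.measurable) hOs hO0
    (fun t x => by simp only [Function.comp, map_smul, pointForm_smul_smul]) hpos
  have hset : {u | chartVec u ∈ O ∨ -chartVec u ∈ O} = {u : Fin 3 → ℝ | ∀ i, 0 ≤ u i} := by
    ext u
    constructor
    · rintro (h | h)
      · intro i
        have h3 := h ((1 : Fin 4).succAbove i)
        fin_cases i <;> simpa [chartVec, Fin.succAbove] using h3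
      · have h3 := h 1
        simp [chartVec] at h3
        linarith
    · intro h
      left
      intro i
      fin_cases i <;> simp [chartVec, h _]
  have hvol : {x | x ∈ vertexMap v '' O ∧ pointForm Λ x x < 1} =
      vertexMap v '' {a | a ∈ O ∧ pointForm Λ (vertexMap v a) (vertexMap v a) < 1} := by
    ext x
    constructor
    · rintro ⟨⟨a, ha, rfl⟩, hx⟩
      exact ⟨a, ⟨ha, hx⟩, rfl⟩
    · rintro ⟨a, ⟨ha, hx⟩, rfl⟩
      exact ⟨⟨a, ha, rfl⟩, hx⟩
  have hdet : LinearMap.det (vertexMap v) = (Matrix.of v).det := by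
    rw [vertexMap, LinearMap.det_toLin', Matrix.det_transpose]
  rw [hvol, Measure.addHaar_image_linearMap, hdet] at h1
  rw [hset] at h2
  simp only [Function.comp] at h2
  rw [h2, mul_left_comm, ← h1, volX]
  simp only [mk_mem_geodesicSimplex_iff]
  refine setLIntegral_congr_fun ((measurable_chartVec hKm).union (measurable_chartVec.neg hKm)) fun u hu => ?_
  have hmem := (mk_mem_geodesicSimplex_iff v (chartVec_ne_zero u)).2 hu
  rw [sqrt_abs_det_metricMatrix ((mk_mem_spaceX Λ _ _).1 (hv.subset_space hmem))]

/-! ### Iterated integrals -/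

/-- The coordinate `u 0` is innermost because it is the coefficient of vertex 0, and varying it
moves along the geodesics through that vertex. -/
theorem lintegral_pi_fin_three (ν : Measure ℝ) [SigmaFinite ν] (F : (Fin 3 → ℝ) → ENNReal)
    (hF : Measurable F) : ∫⁻ u, F u ∂Measure.pi (fun _ => ν) =
      ∫⁻ x, ∫⁻ y, ∫⁻ a, F ![a, x, y] ∂ν ∂ν ∂ν := by
  have e := (measurePreserving_piFinSuccAbove (fun _ : Fin 3 => ν) 0).symm
  have hm : Measurable fun p : ℝ × (Fin 2 → ℝ) =>
      F ((MeasurableEquiv.piFinSuccAbove (fun _ : Fin 3 => ℝ) 0).symm p) :=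
    hF.comp (MeasurableEquiv.measurable _)
  have e2 := (measurePreserving_piFinTwo (fun _ : Fin 2 => ν)).symm
  have hm2 : Measurable fun w : Fin 2 → ℝ => ∫⁻ a,
      F ((MeasurableEquiv.piFinSuccAbove (fun _ : Fin 3 => ℝ) 0).symm (a, w)) ∂ν :=
    hm.lintegral_prod_left'
  rw [← e.lintegral_comp_emb (MeasurableEquiv.measurableEmbedding _),
    lintegral_prod_symm _ hm.aemeasurable,
    ← e2.lintegral_comp_emb (MeasurableEquiv.measurableEmbedding _)]
  refine (lintegral_prod _ (hm2.comp (MeasurableEquiv.measurable _)).aemeasurable).trans ?_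
  refine lintegral_congr fun x => lintegral_congr fun y => lintegral_congr fun a => ?_
  congr 1
  ext i
  fin_cases i <;> rfl

theorem setLIntegral_nonneg_fin_three (F : (Fin 3 → ℝ) → ENNReal) (hF : Measurable F) :
    ∫⁻ u in {u : Fin 3 → ℝ | ∀ i, 0 ≤ u i}, F u =
      ∫⁻ x in Set.Ioi 0, ∫⁻ y in Set.Ioi 0, ∫⁻ a in Set.Ioi 0, F ![a, x, y] := by
  have hset : {u : Fin 3 → ℝ | ∀ i, 0 ≤ u i} = Set.pi Set.univ fun _ => Set.Ici 0 := by
    ext u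
    simp [Pi.le_def]
  rw [hset, volume_pi, Measure.restrict_pi_pi, ← lintegral_pi_fin_three _ _ hF,
    Measure.restrict_congr_set Ioi_ae_eq_Ici]

/-- The substitution `x = X (Y + m)`, `y = Y (X + m)`. -/
theorem lintegral_quadrant_quadratic {m : ℝ} (hm : 0 < m) (F : ℝ → ℝ → ENNReal)
    (hF : Measurable (Function.uncurry F)) :
    ∫⁻ x in Set.Ioi 0, ∫⁻ y in Set.Ioi 0, F x y = ∫⁻ X in Set.Ioi 0, ∫⁻ Y in Set.Ioi 0,
      ENNReal.ofReal (m * (X + Y + m)) * F (X * (Y + m)) (Y * (X + m)) := by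
  rw [lintegral_lintegral_swap hF.aemeasurable]
  -- One variable is replaced at a time: x at fixed y, where Y = y / (X + m), and then y at fixed X.
  -- The factors multiply to m (X + Y + m).
  have h1 : ∫⁻ y in Set.Ioi 0, ∫⁻ x in Set.Ioi 0, F x y =
      ∫⁻ y in Set.Ioi 0, ∫⁻ X in Set.Ioi 0,
        ENNReal.ofReal (y * m / (X + m) ^ 2 + m) * F (X * (y / (X + m) + m)) y :=
    setLIntegral_congr_fun measurableSet_Ioi fun y (hy : 0 < y) =>
      lintegral_Ioi_mobius hy hm fun x => F x y
  rw [h1, lintegral_lintegral_swap]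
  · refine setLIntegral_congr_fun measurableSet_Ioi fun X (hX : 0 < X) => ?_
    have hXm : 0 < X + m := by positivity
    rw [lintegral_Ioi_mul_left hXm]
    refine setLIntegral_congr_fun measurableSet_Ioi fun Y (hY : 0 < Y) => ?_
    rw [← mul_assoc, ← ENNReal.ofReal_mul hXm.le]
    congr 2
    · field_simp
      ring
    · field_simp
    · ring
  · refine (Measurable.mul (by fun_prop) ?_).aemeasurable
    have hg : Measurable fun p : ℝ × ℝ => (p.2 * (p.1 / (p.2 + m) + m), p.1) := by fun_prop
    exact hF.comp hg

/-! ### The integral along the geodesics through a vertex -/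

/-- `P` is the area function `∫₀ᵘ s_Λ²`. -/
def IsAreaFunction (Λ : SignType) (P : ℝ → ℝ) : Prop :=
  P 0 = 0 ∧ ∀ x, HasDerivAt P (genSin Λ x ^ 2) x

/-- The quadratic is the form at a v₀ + ρ p for a unit point p at distance u from v₀. With a = ρ
s(r)/s(u - r), the variable r is the distance from p, and the integrand becomes s(u - r)²/(ρ s(u))³,
whose integral is given by P. -/
theorem lintegral_radial {Λ : SignType} {P : ℝ → ℝ} (hP : IsAreaFunction Λ P) {u ρ : ℝ}
    (hu : IsGenAngle Λ u) (hρ : 0 < ρ) :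
    ∫⁻ a in Set.Ioi 0, ENNReal.ofReal (((a ^ 2 + 2 * a * (ρ * genCos Λ u) + ρ ^ 2) ^ 2)⁻¹) =
      ENNReal.ofReal (P u / (ρ * genSin Λ u) ^ 3) := by
  have hS := hu.genSin_pos
  have hc : 0 < ρ / genSin Λ u := by positivity
  rw [lintegral_Ioi_const_div hc, hu.lintegral_cot]
  trans ∫⁻ r in Set.Ioo 0 u, ENNReal.ofReal (genSin Λ (u - r) ^ 2 / (ρ * genSin Λ u) ^ 3)
  · refine setLIntegral_congr_fun measurableSet_Ioo fun r hr => ?_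
    have hSr := (hu.mono hr.1 hr.2.le).genSin_pos
    have hw : 0 < genSin Λ (u - r) :=
      (hu.mono (sub_pos.2 hr.2) (by linarith [hr.1])).genSin_pos
    have hwe := genSin_sub Λ u r
    have hZ : genCos Λ r / genSin Λ r - genCos Λ u / genSin Λ u =
        genSin Λ (u - r) / (genSin Λ r * genSin Λ u) := by
      rw [hwe]
      field_simp
    have hQ : (ρ / genSin Λ u / (genSin Λ (u - r) / (genSin Λ r * genSin Λ u))) ^ 2 +
        2 * (ρ / genSin Λ u / (genSin Λ (u - r) / (genSin Λ r * genSin Λ u))) *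
          (ρ * genCos Λ u) + ρ ^ 2 = (ρ * genSin Λ u / genSin Λ (u - r)) ^ 2 := by
      field_simp
      rw [hwe]
      linear_combination (genSin Λ u ^ 2) * genCos_sq_add Λ r -
        (genSin Λ r ^ 2) * genCos_sq_add Λ u
    rw [hZ, hQ, ← ENNReal.ofReal_mul (by positivity), ← ENNReal.ofReal_mul (by positivity)]
    congr 1
    field_simp
  · rw [lintegral_Ioo_ofReal_deriv (F := fun r => -P (u - r) / (ρ * genSin Λ u) ^ 3) hu.1.le]
    · simp only [sub_self, hP.1, sub_zero]
      congr 1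
      ring
    · have hPc : Continuous P := continuous_iff_continuousAt.2 fun x => (hP.2 x).continuousAt
      fun_prop
    · intro r _
      have h := ((hP.2 (u - r)).comp_const_sub u r).neg.div_const ((ρ * genSin Λ u) ^ 3)
      simpa using h
    · intro r _
      positivity

/-! ### The parametrization of a face -/

section FaceParametrization

variable {L Sa Ca Sb Cb Ss Cs St Ct : ℝ}

/-- The letters S, C with index a, b, s, t are sine and cosine at α, β, s, t, and g is the sine of α
+ β. The bracket on the right is the sine of α + t - s, so the coordinate of the face point
satisfies x g = ρ s(α + t - s) - s(β). -/
theorem face_coordinate {g : ℝ} (ha : Ca ^ 2 + L * Sa ^ 2 = 1) (hSa : Sa ≠ 0) (hSb : Sb ≠ 0)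
    (hSs : Ss ≠ 0) (hSt : St ≠ 0) (hg : g = Sa * Cb + Ca * Sb) (hg0 : g ≠ 0) :
    Sb * Sa ^ 2 / g * ((Cs / Ss - Ca / Sa) * (Ct / St - Cb / Sb + g / (Sa * Sb))) * g =
      Sa * Sb / (Ss * St) * (Sa * (Cs * Ct + L * (Ss * St)) + Ca * (Cs * St - Ss * Ct)) - Sb := by
  have h : Ct / St - Cb / Sb + g / (Sa * Sb) = Ct / St + Ca / Sa := by
    rw [hg]
    field_simp
    ring
  rw [h]
  field_simp
  linear_combination (-Ss * St) * ha

/-- The left side is the product of vertex 0 with the face point. Its value ρ times the cosine of s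
+ t shows that the face point is at distance s + t from vertex 0. -/
theorem face_linear {g ρ x y : ℝ} (ha : Ca ^ 2 + L * Sa ^ 2 = 1) (hb : Cb ^ 2 + L * Sb ^ 2 = 1)
    (hg : g = Sa * Cb + Ca * Sb) (hg0 : g ≠ 0) (hρ : ρ * (Ss * St) = Sa * Sb)
    (hx : x * g = ρ * (Sa * (Cs * Ct + L * (Ss * St)) + Ca * (Cs * St - Ss * Ct)) - Sb)
    (hy : y * g = ρ * (Sb * (Cs * Ct + L * (Ss * St)) - Cb * (Cs * St - Ss * Ct)) - Sa) :
    (Ca * Cb - L * (Sa * Sb)) + Cb * x + Ca * y = ρ * (Cs * Ct - L * (Ss * St)) := by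
  subst hg
  refine mul_left_cancel₀ hg0 ?_
  linear_combination Cb * hx + Ca * hy + Sa * Ca * hb + Sb * Cb * ha +
    2 * L * (Sa * Cb + Ca * Sb) * hρ

/-- The form on a lightlike face has rank at most two: it is (1 + x Ca + y Cb)² + L (x Sa - y Sb)².
In the given coordinates the two terms are ρ times the cosine and the sine of α - β + t - s. -/
theorem face_quadratic {g ρ x y : ℝ} (ha : Ca ^ 2 + L * Sa ^ 2 = 1)
    (hb : Cb ^ 2 + L * Sb ^ 2 = 1) (hs : Cs ^ 2 + L * Ss ^ 2 = 1) (ht : Ct ^ 2 + L * St ^ 2 = 1)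
    (hg : g = Sa * Cb + Ca * Sb) (hg0 : g ≠ 0)
    (hx : x * g = ρ * (Sa * (Cs * Ct + L * (Ss * St)) + Ca * (Cs * St - Ss * Ct)) - Sb)
    (hy : y * g = ρ * (Sb * (Cs * Ct + L * (Ss * St)) - Cb * (Cs * St - Ss * Ct)) - Sa) :
    1 + x ^ 2 + y ^ 2 + 2 * x * Ca + 2 * y * Cb + 2 * x * y * (Ca * Cb - L * (Sa * Sb)) =
      ρ ^ 2 := by
  subst hg
  have h2 : (Cs * Ct + L * (Ss * St)) ^ 2 + L * (Cs * St - Ss * Ct) ^ 2 = 1 := by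
    linear_combination (Ct ^ 2 + L * St ^ 2) * hs + ht
  generalize Cs * Ct + L * (Ss * St) = c at hx hy h2
  generalize Cs * St - Ss * Ct = n at hx hy h2
  have hp : 1 + x * Ca + y * Cb =
      ρ * ((Ca * Cb + L * (Sa * Sb)) * c - L * (Sa * Cb - Ca * Sb) * n) := by
    refine mul_left_cancel₀ hg0 ?_
    linear_combination Ca * hx + Cb * hy - ρ * c * (Sa * Ca * hb + Sb * Cb * ha) +
      ρ * n * (Cb ^ 2 * ha - Ca ^ 2 * hb)
  have hn : x * Sa - y * Sb =
      ρ * ((Sa * Cb - Ca * Sb) * c + (Ca * Cb + L * (Sa * Sb)) * n) := by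
    refine mul_left_cancel₀ hg0 ?_
    linear_combination Sa * hx - Sb * hy + ρ * c * (Sb ^ 2 * ha - Sa ^ 2 * hb) -
      ρ * n * (Sa * Ca * hb + Sb * Cb * ha)
  have h1 : (Ca * Cb + L * (Sa * Sb)) ^ 2 + L * (Sa * Cb - Ca * Sb) ^ 2 = 1 := by
    linear_combination (Cb ^ 2 + L * Sb ^ 2) * ha + hb
  have h3 : (1 + x * Ca + y * Cb) ^ 2 + L * (x * Sa - y * Sb) ^ 2 = ρ ^ 2 := by
    rw [hp, hn]
    linear_combination ρ ^ 2 * ((c ^ 2 + L * n ^ 2) * h1 + h2)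
  linear_combination h3 - x ^ 2 * ha - y ^ 2 * hb

end FaceParametrization

/-- The volume of the cone over the face opposite to a vertex, in geodesic polar coordinates
around this vertex. -/
theorem lintegral_tetrahedron {Λ : SignType} {P : ℝ → ℝ} (hP : IsAreaFunction Λ P) {α β : ℝ}
    (hα : 0 < α) (hβ : 0 < β) (hγ : IsGenAngle Λ (α + β)) :
    ENNReal.ofReal (2 * genSin Λ (α + β) * genSin Λ β * genSin Λ α) *
      ∫⁻ x in Set.Ioi 0, ∫⁻ y in Set.Ioi 0, ∫⁻ a in Set.Ioi 0, ENNReal.ofReal (((a ^ 2 +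
        2 * a * (genCos Λ (α + β) + genCos Λ β * x + genCos Λ α * y) + (1 + x ^ 2 + y ^ 2 +
        2 * x * genCos Λ α + 2 * y * genCos Λ β + 2 * x * y * genCos Λ (α + β))) ^ 2)⁻¹) =
    ∫⁻ s in Set.Ioo 0 α, ∫⁻ t in Set.Ioo 0 β,
      ENNReal.ofReal (2 * P (s + t) / genSin Λ (s + t) ^ 2) := by
  have hα' : IsGenAngle Λ α := hγ.mono hα (by linarith)
  have hβ' : IsGenAngle Λ β := hγ.mono hβ (by linarith)
  have ha := hα'.genSin_pos
  have hb := hβ'.genSin_pos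
  have hg := hγ.genSin_pos
  have hge := genSin_add Λ α β
  have hgc := genCos_add Λ α β
  set D := 2 * genSin Λ (α + β) * genSin Λ β * genSin Λ α
  -- The constant m is cot α + cot β. With X = cot s - cot α and Y = cot t - cot β, the face
  -- coordinates are x = c₂ X (Y + m) and y = c₃ Y (X + m), so the sides x = 0 and y = 0 correspond
  -- to s = α and t = β.
  set c₂ := genSin Λ β * genSin Λ α ^ 2 / genSin Λ (α + β) with hc₂
  set c₃ := genSin Λ α * genSin Λ β ^ 2 / genSin Λ (α + β) with hc₃
  set m := genSin Λ (α + β) / (genSin Λ α * genSin Λ β) with hm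
  have hc₂0 : 0 < c₂ := by positivity
  have hc₃0 : 0 < c₃ := by positivity
  have hm0 : 0 < m := by positivity
  set F : ℝ → ℝ → ENNReal := fun x y => ∫⁻ a in Set.Ioi 0, ENNReal.ofReal (((a ^ 2 +
        2 * a * (genCos Λ (α + β) + genCos Λ β * x + genCos Λ α * y) + (1 + x ^ 2 + y ^ 2 +
        2 * x * genCos Λ α + 2 * y * genCos Λ β + 2 * x * y * genCos Λ (α + β))) ^ 2)⁻¹) with hF
  have hFm : Measurable (Function.uncurry F) := by
    refine Measurable.lintegral_prod_right' (f := fun p : (ℝ × ℝ) × ℝ => ENNReal.ofReal (((p.2 ^ 2 +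
        2 * p.2 * (genCos Λ (α + β) + genCos Λ β * p.1.1 + genCos Λ α * p.1.2) +
        (1 + p.1.1 ^ 2 + p.1.2 ^ 2 + 2 * p.1.1 * genCos Λ α + 2 * p.1.2 * genCos Λ β +
        2 * p.1.1 * p.1.2 * genCos Λ (α + β))) ^ 2)⁻¹)) ?_
    fun_prop
  have h1 : ∫⁻ x in Set.Ioi 0, ∫⁻ y in Set.Ioi 0, F x y =
      ∫⁻ x in Set.Ioi 0, ∫⁻ y in Set.Ioi 0,
        ENNReal.ofReal c₂ * (ENNReal.ofReal c₃ * F (c₂ * x) (c₃ * y)) := by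
    rw [lintegral_Ioi_mul_left hc₂0]
    refine lintegral_congr fun x => ?_
    rw [lintegral_Ioi_mul_left hc₃0, lintegral_const_mul' _ _ ENNReal.ofReal_ne_top,
      lintegral_const_mul' _ _ ENNReal.ofReal_ne_top,
      lintegral_const_mul' _ _ ENNReal.ofReal_ne_top]
  have hFm2 : Measurable (Function.uncurry fun x y : ℝ =>
      ENNReal.ofReal c₂ * (ENNReal.ofReal c₃ * F (c₂ * x) (c₃ * y))) := by
    have hg' : Measurable fun p : ℝ × ℝ => (c₂ * p.1, c₃ * p.2) := by fun_prop
    exact ((hFm.comp hg').const_mul _).const_mul _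
  rw [h1, lintegral_quadrant_quadratic hm0 _ hFm2, hα'.lintegral_cot,
    ← lintegral_const_mul' _ _ ENNReal.ofReal_ne_top]
  refine setLIntegral_congr_fun measurableSet_Ioo fun s hs => ?_
  rw [hβ'.lintegral_cot, ← lintegral_const_mul' _ _ ENNReal.ofReal_ne_top,
    ← lintegral_const_mul' _ _ ENNReal.ofReal_ne_top]
  refine setLIntegral_congr_fun measurableSet_Ioo fun t ht => ?_
  have hu : IsGenAngle Λ (s + t) :=
    hγ.mono (add_pos hs.1 ht.1) (add_le_add hs.2.le ht.2.le)
  have hSs := (hα'.mono hs.1 hs.2.le).genSin_pos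
  have hSt := (hβ'.mono ht.1 ht.2.le).genSin_pos
  have hSu := hu.genSin_pos
  have ea := genCos_sq_add Λ α
  have eb := genCos_sq_add Λ β
  have es := genCos_sq_add Λ s
  have et := genCos_sq_add Λ t
  set X := genCos Λ s / genSin Λ s - genCos Λ α / genSin Λ α with hX
  set Y := genCos Λ t / genSin Λ t - genCos Λ β / genSin Λ β with hY
  -- By `face_quadratic`, ρ is the norm of the unnormalized face point.
  set ρ := genSin Λ α * genSin Λ β / (genSin Λ s * genSin Λ t) with hρ
  have hρ0 : 0 < ρ := by positivity
  have hx : c₂ * (X * (Y + m)) * genSin Λ (α + β) =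
      ρ * (genSin Λ α * (genCos Λ s * genCos Λ t + Λ * (genSin Λ s * genSin Λ t)) +
        genCos Λ α * (genCos Λ s * genSin Λ t - genSin Λ s * genCos Λ t)) - genSin Λ β :=
    face_coordinate ea ha.ne' hb.ne' hSs.ne' hSt.ne' hge hg.ne'
  have hy : c₃ * (Y * (X + m)) * genSin Λ (α + β) =
      ρ * (genSin Λ β * (genCos Λ s * genCos Λ t + Λ * (genSin Λ s * genSin Λ t)) -
        genCos Λ β * (genCos Λ s * genSin Λ t - genSin Λ s * genCos Λ t)) - genSin Λ α := by
    have h2 := face_coordinate (Cs := genCos Λ t) (Ct := genCos Λ s) eb hb.ne' ha.ne' hSt.ne'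
      hSs.ne' (hge.trans (by ring : _ = genSin Λ β * genCos Λ α + genCos Λ β * genSin Λ α)) hg.ne'
    rw [mul_comm (genSin Λ β) (genSin Λ α)] at h2
    rw [hc₃, hY, hX, hm, h2, hρ, mul_comm (genSin Λ t) (genSin Λ s)]
    ring
  have hlin := face_linear (Cs := genCos Λ s) (Ct := genCos Λ t) ea eb hge hg.ne'
    (by rw [hρ]; field_simp) hx hy
  have hquad := face_quadratic ea eb es et hge hg.ne' hx hy
  have hXY : X + Y + m = genSin Λ (s + t) / (genSin Λ s * genSin Λ t) := by
    rw [hX, hY, hm, hge, genSin_add]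
    field_simp
    ring
  have hF2 : F (c₂ * (X * (Y + m))) (c₃ * (Y * (X + m))) =
      ENNReal.ofReal (P (s + t) / (ρ * genSin Λ (s + t)) ^ 3) := by
    rw [← lintegral_radial hP hu hρ0]
    simp only [hF]
    refine lintegral_congr fun a => ?_
    rw [hgc, hlin, hquad, ← genCos_add]
  rw [hF2, hXY]
  rw [← ENNReal.ofReal_mul (by positivity), ← ENNReal.ofReal_mul (by positivity),
    ← ENNReal.ofReal_mul (by positivity), ← ENNReal.ofReal_mul (by positivity),
    ← ENNReal.ofReal_mul (by positivity), ← ENNReal.ofReal_mul (by positivity)]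
  congr 1
  rw [hc₂, hc₃, hm, hρ]
  simp only [D]
  field_simp

/-! ### The remaining double integral -/

/-- The second difference of a double antiderivative. The constant c is free because the linear term
c x has vanishing second difference. At 0 only continuity of H is asked for, as K need not be
defined well there; nonnegativity of f makes K monotone and the result nonnegative. -/
theorem lintegral_Ioo_Ioo_add {f K H : ℝ → ℝ} {c α β : ℝ} (hα : 0 < α) (hβ : 0 < β)
    (hK : ∀ x ∈ Set.Ioc 0 (α + β), HasDerivAt K (f x) x)
    (hf : ∀ x ∈ Set.Ioc 0 (α + β), 0 ≤ f x) (hH : ContinuousOn H (Set.Icc 0 (α + β)))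
    (hH' : ∀ x ∈ Set.Ioc 0 (α + β), HasDerivAt H (K x + c) x) :
    0 ≤ H (α + β) - H α - H β + H 0 ∧
      ∫⁻ s in Set.Ioo 0 α, ∫⁻ t in Set.Ioo 0 β, ENNReal.ofReal (f (s + t)) =
        ENNReal.ofReal (H (α + β) - H α - H β + H 0) := by
  have hmono : MonotoneOn K (Set.Ioc 0 (α + β)) := by
    refine monotoneOn_of_deriv_nonneg (convex_Ioc _ _)
      (fun x hx => (hK x hx).continuousAt.continuousWithinAt)
      (fun x hx => (hK x (interior_subset hx)).differentiableAt.differentiableWithinAt)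
      (fun x hx => ?_)
    rw [(hK x (interior_subset hx)).deriv]
    exact hf x (interior_subset hx)
  have hcont : ContinuousOn (fun s => H (s + β) - H s) (Set.Icc 0 α) := by
    refine ContinuousOn.sub (hH.comp (by fun_prop) fun s hs => ?_) (hH.mono fun s hs => ?_)
    · exact ⟨by linarith [hs.1], by linarith [hs.2]⟩
    · exact ⟨hs.1, by linarith [hs.2]⟩
  have hder : ∀ s ∈ Set.Ioo 0 α,
      HasDerivAt (fun s => H (s + β) - H s) (K (s + β) - K s) s := fun s hs => by
    have h1 := (hH' (s + β) ⟨by linarith [hs.1], by linarith [hs.2]⟩).comp_add_const s β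
    exact (h1.sub (hH' s ⟨hs.1, by linarith [hs.2]⟩)).congr_deriv (by ring)
  have hnonneg : ∀ s ∈ Set.Ioo 0 α, 0 ≤ K (s + β) - K s := fun s hs =>
    sub_nonneg.2 (hmono ⟨hs.1, by linarith [hs.2]⟩ ⟨by linarith [hs.1], by linarith [hs.2]⟩
      (by linarith))
  constructor
  · have := monotoneOn_of_deriv_nonneg (convex_Icc 0 α) hcont
      (fun s hs => (hder s (by simpa using hs)).differentiableAt.differentiableWithinAt)
      (fun s hs => by
        rw [(hder s (by simpa using hs)).deriv]
        exact hnonneg s (by simpa using hs))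
      ⟨le_rfl, hα.le⟩ ⟨hα.le, le_rfl⟩ hα.le
    simp only [zero_add] at this
    linarith
  · have hin : ∀ s ∈ Set.Ioo 0 α, ∫⁻ t in Set.Ioo 0 β, ENNReal.ofReal (f (s + t)) =
        ENNReal.ofReal (K (s + β) - K s) := fun s hs => by
      have hmem : ∀ t ∈ Set.Icc 0 β, s + t ∈ Set.Ioc 0 (α + β) := fun t ht =>
        ⟨by linarith [hs.1, ht.1], by linarith [hs.2, ht.2]⟩
      have := lintegral_Ioo_ofReal_deriv (F := fun t => K (s + t)) (f := fun t => f (s + t)) hβ.le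
        (fun t ht => ((hK _ (hmem t ht)).comp_const_add s t).continuousAt.continuousWithinAt)
        (fun t ht => (hK _ (hmem t ⟨ht.1.le, ht.2.le⟩)).comp_const_add s t)
        (fun t ht => hf _ (hmem t ⟨ht.1.le, ht.2.le⟩))
      simpa using this
    rw [setLIntegral_congr_fun measurableSet_Ioo hin,
      lintegral_Ioo_ofReal_deriv hα.le hcont hder hnonneg]
    congr 1
    simp only [zero_add]
    ring

theorem IsAreaFunction.nonneg {Λ : SignType} {P : ℝ → ℝ} (hP : IsAreaFunction Λ P) {x : ℝ}
    (hx : 0 ≤ x) : 0 ≤ P x := by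
  have := monotone_of_hasDerivAt_nonneg hP.2 (fun x => sq_nonneg _) hx
  rwa [hP.1] at this

theorem isAreaFunction_zero : IsAreaFunction 0 fun u => u ^ 3 / 3 := by
  refine ⟨by simp, fun x => ?_⟩
  refine ((hasDerivAt_pow 3 x).div_const 3).congr_deriv ?_
  change _ = x ^ 2
  push_cast
  ring

theorem isAreaFunction_of_ne_zero {Λ : SignType} (h : Λ ≠ 0) :
    IsAreaFunction Λ fun u => (Λ : ℝ) / 2 * (u - genSin Λ u * genCos Λ u) := by
  refine ⟨by simp [genSin_zero], fun x => ?_⟩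
  refine (((hasDerivAt_id x).sub
    ((hasDerivAt_genSin Λ x).mul (hasDerivAt_genCos Λ x))).const_mul ((Λ : ℝ) / 2)).congr_deriv ?_
  linear_combination (-(Λ : ℝ) / 2) * genCos_sq_add Λ x + genSin Λ x ^ 2 * sq_cast_of_ne_zero h

theorem lintegral_area_zero {α β : ℝ} (hα : 0 < α) (hβ : 0 < β) :
    0 ≤ α * β * (α + β) / 3 ∧
      ∫⁻ s in Set.Ioo 0 α, ∫⁻ t in Set.Ioo 0 β,
        ENNReal.ofReal (2 * ((s + t) ^ 3 / 3) / genSin 0 (s + t) ^ 2) =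
          ENNReal.ofReal (α * β * (α + β) / 3) := by
  -- Here f(u) = 2u/3, and the second difference of u³/9 is αβ(α + β)/3.
  have := lintegral_Ioo_Ioo_add (f := fun u => 2 * (u ^ 3 / 3) / genSin 0 u ^ 2)
    (K := fun u => u ^ 2 / 3) (H := fun u => u ^ 3 / 9) (c := 0) hα hβ
    (fun x hx => ((hasDerivAt_pow 2 x).div_const 3).congr_deriv ?_)
    (fun x hx => ?_) (by fun_prop)
    (fun x hx => ((hasDerivAt_pow 3 x).div_const 9).congr_deriv (by push_cast; ring))
  · convert this using 3 <;> ring_nf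
  · have hx0 : x ≠ 0 := hx.1.ne'
    change _ = 2 * (x ^ 3 / 3) / x ^ 2
    field_simp
    norm_num
  · have hx0 : 0 < x := hx.1
    positivity

/-! ### Clausen functions and the contribution of an edge -/

theorem log_genSin_intervalIntegrable (Λ : SignType) (a b : ℝ) :
    IntervalIntegrable (fun θ => Real.log |2 * genSin Λ (θ / 2)|) volume a b := by
  simp only [Real.log_abs]
  apply MeromorphicOn.intervalIntegrable_log
  intro x _
  apply AnalyticAt.meromorphicAt
  refine analyticAt_const.mul ?_
  rcases Λ with _ | _ | _
  · change AnalyticAt ℝ (fun θ : ℝ => θ / 2) x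
    fun_prop
  · change AnalyticAt ℝ (fun θ : ℝ => Real.sinh (θ / 2)) x
    fun_prop
  · change AnalyticAt ℝ (fun θ : ℝ => Real.sin (θ / 2)) x
    fun_prop

theorem genClausen_zero (Λ : SignType) : genClausen Λ 0 = 0 := by simp [genClausen]

theorem genClausen_neg (Λ : SignType) (x : ℝ) : genClausen Λ (-x) = -genClausen Λ x := by
  have h := intervalIntegral.integral_comp_neg (a := 0) (b := x)
    (fun θ => Real.log |2 * genSin Λ (θ / 2)|)
  simp only [neg_div, genSin_neg, mul_neg, abs_neg, neg_zero] at h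
  rw [genClausen, genClausen, h, intervalIntegral.integral_symm (-x) 0]

theorem continuous_genClausen (Λ : SignType) : Continuous (genClausen Λ) :=
  (intervalIntegral.continuous_primitive (log_genSin_intervalIntegrable Λ) 0).neg

theorem hasDerivAt_genClausen {Λ : SignType} {x : ℝ} (hx : IsGenAngle Λ x) :
    HasDerivAt (fun x => genClausen Λ (2 * x)) (-(2 * Real.log (2 * genSin Λ x))) x := by
  have hc : ContinuousAt (fun θ => Real.log |2 * genSin Λ (θ / 2)|) (2 * x) := by
    simp only [Real.log_abs]
    refine ContinuousAt.log ?_ ?_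
    · exact ((continuous_genSin Λ).comp (by fun_prop : Continuous fun θ : ℝ => θ / 2)).continuousAt.const_mul 2
    · have := hx.genSin_pos
      rw [mul_div_cancel_left₀ _ two_ne_zero]
      positivity
  have hm : Measurable (fun θ => Real.log |2 * genSin Λ (θ / 2)|) := by
    have := (continuous_genSin Λ).measurable
    fun_prop
  have h := intervalIntegral.integral_hasDerivAt_right (log_genSin_intervalIntegrable Λ 0 (2 * x))
    hm.stronglyMeasurable.stronglyMeasurableAtFilter hc
  have h2 := (h.neg.comp x ((hasDerivAt_id x).const_mul 2))
  refine h2.congr_deriv ?_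
  simp only [mul_one, Real.log_abs, mul_div_cancel_left₀ _ (two_ne_zero (α := ℝ))]
  ring

/-- The contribution of an edge of length `x` to the volume. -/
noncomputable def edgeVolume (Λ : SignType) (x : ℝ) : ℝ :=
  1 / 2 * genClausen Λ (2 * x) + x * Real.log |genSin Λ x|

theorem edgeVolume_zero (Λ : SignType) : edgeVolume Λ 0 = 0 := by
  simp [edgeVolume, genClausen_zero]

theorem edgeVolume_neg (Λ : SignType) (x : ℝ) : edgeVolume Λ (-x) = -edgeVolume Λ x := by
  rw [edgeVolume, edgeVolume, mul_neg, genClausen_neg, genSin_neg, abs_neg]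
  ring

/-- The two log s(x) terms, from the Clausen function and from x log s(x), cancel. This leaves x cot
x, the nonelementary part of the antiderivative needed, and a harmless constant. -/
theorem hasDerivAt_edgeVolume {Λ : SignType} {x : ℝ} (hx : IsGenAngle Λ x) :
    HasDerivAt (edgeVolume Λ) (x * genCos Λ x / genSin Λ x - Real.log 2) x := by
  have hS := hx.genSin_pos
  have h := ((hasDerivAt_genClausen hx).const_mul (1 / 2)).add
    ((hasDerivAt_id x).mul ((hasDerivAt_genSin Λ x).log hS.ne'))
  have he : edgeVolume Λ =
      fun x => 1 / 2 * genClausen Λ (2 * x) + id x * Real.log (genSin Λ x) := by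
    funext x
    simp [edgeVolume]
  rw [he]
  refine h.congr_deriv ?_
  rw [Real.log_mul two_ne_zero hS.ne']
  simp only [id]
  ring

/-- Writing s(x) = x h(x) with h the difference quotient, h(0) = 1, splits x log|s(x)| into x log x
and x log h(x), both continuous at 0. -/
theorem continuousAt_edgeVolume_zero (Λ : SignType) : ContinuousAt (edgeVolume Λ) 0 := by
  have hq : ContinuousAt (dslope (genSin Λ) 0) 0 :=
    continuousAt_dslope_same.2 (hasDerivAt_genSin Λ 0).differentiableAt
  have hq0 : dslope (genSin Λ) 0 0 = 1 := by
    rw [dslope_same, (hasDerivAt_genSin Λ 0).deriv, genCos_zero]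
  have hS : ∀ x, genSin Λ x = x * dslope (genSin Λ) 0 x := fun x => by
    have := sub_smul_dslope (genSin Λ) 0 x
    simpa [genSin_zero] using this.symm
  have hl : ContinuousAt (fun x => x * Real.log (dslope (genSin Λ) 0 x)) 0 :=
    continuousAt_id.mul (hq.log (by rw [hq0]; exact one_ne_zero))
  have hsum := (((continuous_genClausen Λ).comp
    (continuous_const_mul (2 : ℝ))).continuousAt (x := 0)).const_mul (1 / 2) |>.add
      ((Real.continuous_mul_log.continuousAt (x := 0)).add hl)
  refine hsum.congr ?_
  have hne : ∀ᶠ x in nhds (0 : ℝ), dslope (genSin Λ) 0 x ≠ 0 :=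
    hq.eventually_ne (by rw [hq0]; exact one_ne_zero)
  filter_upwards [hne] with x hx
  rcases eq_or_ne x 0 with rfl | h0
  · simp [edgeVolume]
  · simp only [Pi.add_apply, edgeVolume, Function.comp, Real.log_abs, hS x, Real.log_mul h0 hx]
    ring

theorem lintegral_area_of_ne_zero {Λ : SignType} (h : Λ ≠ 0) {α β : ℝ} (hα : 0 < α) (hβ : 0 < β)
    (hγ : IsGenAngle Λ (α + β)) :
    0 ≤ (Λ : ℝ) * (edgeVolume Λ α + edgeVolume Λ β + edgeVolume Λ (-(α + β))) ∧
      ∫⁻ s in Set.Ioo 0 α, ∫⁻ t in Set.Ioo 0 β,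
        ENNReal.ofReal (2 * ((Λ : ℝ) / 2 * (s + t - genSin Λ (s + t) * genCos Λ (s + t))) /
          genSin Λ (s + t) ^ 2) =
      ENNReal.ofReal
        ((Λ : ℝ) * (edgeVolume Λ α + edgeVolume Λ β + edgeVolume Λ (-(α + β)))) := by
  have hang : ∀ x ∈ Set.Ioc 0 (α + β), IsGenAngle Λ x := fun x hx => hγ.mono hx.1 hx.2
  -- With P = (Λ/2)(u - s(u)c(u)), c denoting the generalized cosine, the density is the derivative
  -- of Λ(1 - u cot u). The constant Λ(log 2 - 1) absorbs the 1 here and the log 2 in the derivative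
  -- of `edgeVolume`.
  have key := lintegral_Ioo_Ioo_add
    (f := fun u => 2 * ((Λ : ℝ) / 2 * (u - genSin Λ u * genCos Λ u)) / genSin Λ u ^ 2)
    (K := fun u => (Λ : ℝ) * (1 - u * (genCos Λ u / genSin Λ u)))
    (H := fun u => -(Λ : ℝ) * edgeVolume Λ u) (c := (Λ : ℝ) * (Real.log 2 - 1)) hα hβ
    (fun x hx => ?_) (fun x hx => ?_) (fun x hx => ?_) (fun x hx => ?_)
  · simp only [edgeVolume_zero, edgeVolume_neg] at key ⊢
    convert key using 3 <;> ring
  · have hS := (hang x hx).genSin_pos.ne'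
    refine ((((hasDerivAt_id x).mul (hang x hx).hasDerivAt_cot).const_sub 1).const_mul
      (Λ : ℝ)).congr_deriv ?_
    simp only [id]
    field_simp
    ring
  · have := (isAreaFunction_of_ne_zero h).nonneg hx.1.le
    have h2 := sq_nonneg (genSin Λ x)
    positivity
  · refine ContinuousWithinAt.const_mul (ContinuousAt.continuousWithinAt ?_) _
    rcases hx.1.eq_or_lt with rfl | h0
    · exact continuousAt_edgeVolume_zero Λ
    · exact (hasDerivAt_edgeVolume (hang x ⟨h0, hx.2⟩)).continuousAt
  · refine ((hasDerivAt_edgeVolume (hang x hx)).const_mul (-(Λ : ℝ))).congr_deriv ?_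
    ring

/-! ### The main theorem -/

theorem IsLightlikeTetrahedron.volX_eq_lintegral_area {Λ : SignType} {v : Fin 4 → R4}
    (hv : IsLightlikeTetrahedron Λ v) (h1 : ∀ i, pointForm Λ (v i) (v i) = 1) {P : ℝ → ℝ}
    (hP : IsAreaFunction Λ P) {α β : ℝ} (h03 : genDist Λ (v 0) (v 3) = α)
    (h12 : genDist Λ (v 1) (v 2) = α) (h13 : genDist Λ (v 1) (v 3) = β)
    (h02 : genDist Λ (v 0) (v 2) = β) (h23 : genDist Λ (v 2) (v 3) = α + β)
    (h01 : genDist Λ (v 0) (v 1) = α + β) :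
    volX Λ (geodesicSimplex v) = ∫⁻ s in Set.Ioo 0 α, ∫⁻ t in Set.Ioo 0 β,
      ENNReal.ofReal (2 * P (s + t) / genSin Λ (s + t) ^ 2) := by
  have g : ∀ i j : Fin 4, i ≠ j → pointForm Λ (v i) (v j) = genCos Λ (genDist Λ (v i) (v j)) :=
    fun i j hij => (genDist_spec_of_tetrahedron hv h1 hij).2.1.symm
  have g01 := g 0 1 (by decide)
  have g02 := g 0 2 (by decide)
  have g03 := g 0 3 (by decide)
  have g12 := g 1 2 (by decide)
  have g13 := g 1 3 (by decide)
  have g23 := g 2 3 (by decide)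
  rw [h01] at g01
  rw [h02] at g02
  rw [h03] at g03
  rw [h12] at g12
  rw [h13] at g13
  rw [h23] at g23
  have hα : 0 < α := by
    rw [← h03]; exact (genDist_spec_of_tetrahedron hv h1 (by decide)).1.1
  have hβ : 0 < β := by
    rw [← h02]; exact (genDist_spec_of_tetrahedron hv h1 (by decide)).1.1
  have hγ : IsGenAngle Λ (α + β) := by
    rw [← h01]; exact (genDist_spec_of_tetrahedron hv h1 (by decide)).1
  have hm : Measurable fun u : Fin 3 → ℝ => ENNReal.ofReal
      ((pointForm Λ (vertexMap v (chartVec u)) (vertexMap v (chartVec u)) ^ 2)⁻¹) := by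
    have hl : Measurable (vertexMap v) :=
      (vertexMap v).continuous_of_finiteDimensional.measurable
    have hq : Measurable fun x => pointForm Λ x x := by
      simp only [pointForm]
      fun_prop
    exact ((hq.comp (hl.comp measurable_chartVec)).pow_const 2).inv.ennreal_ofReal
  -- Equality of opposite edges leaves only three distinct off-diagonal Gram entries, so the form is
  -- the one integrated in `lintegral_tetrahedron`.
  have hG : ∀ a x y : ℝ,
      pointForm Λ (vertexMap v (chartVec ![a, x, y])) (vertexMap v (chartVec ![a, x, y])) =
        a ^ 2 + 2 * a * (genCos Λ (α + β) + genCos Λ β * x + genCos Λ α * y) +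
          (1 + x ^ 2 + y ^ 2 + 2 * x * genCos Λ α + 2 * y * genCos Λ β +
            2 * x * y * genCos Λ (α + β)) := by
    intro a x y
    have e0 := h1 0
    have e1 := h1 1
    have e2 := h1 2
    have e3 := h1 3
    rw [← g01, ← g02, ← g03]
    have hx : vertexMap v (chartVec ![a, x, y]) = a • v 0 + v 1 + x • v 2 + y • v 3 := by
      rw [vertexMap_apply, Fin.sum_univ_four]
      simp [chartVec]
    rw [hx]
    simp only [pointForm, Pi.add_apply, Pi.smul_apply, smul_eq_mul] at *
    linear_combination a ^ 2 * e0 + e1 + x ^ 2 * e2 + y ^ 2 * e3 + 2 * x * (g12 - g03) +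
      2 * y * (g13 - g02) + 2 * x * y * (g23 - g01)
  rw [hv.volX_eq, hv.abs_det h1, h01, h02, h03, setLIntegral_nonneg_fin_three _ hm,
    ← lintegral_tetrahedron hP hα hβ hγ]
  simp only [hG]

theorem IsLightlikeTetrahedron.segmentLength_eq_genDist {Λ : SignType} {v : Fin 4 → R4}
    (hv : IsLightlikeTetrahedron Λ v) (h1 : ∀ i, pointForm Λ (v i) (v i) = 1) {c : Fin 4 → ℝ}
    (hc : ∀ i, 0 < c i) {i j : Fin 4} (hij : i ≠ j) :
    segmentLength Λ (c i • v i) (c j • v j) = genDist Λ (v i) (v j) := by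
  obtain ⟨hl, hC, hS⟩ := genDist_spec_of_tetrahedron hv h1 hij
  exact segmentLength_eq (h1 i) (h1 j) hl hC hS
    (fun x y hx hy hxy => hv.pointForm_segment_pos hij hx hy hxy) (hc i) (hc j)

theorem mainTheorem2 (Λ : SignType) (v : Fin 4 → R4) (hv : IsLightlikeTetrahedron Λ v) :
    ∃ (e : Equiv.Perm (Fin 4)) (α β γ : ℝ),
      0 < α ∧ 0 < β ∧ -γ = α + β ∧
      -- opposite edges have the same length, and the three lengths are `α`, `β` and `-γ`
      segmentLength Λ (v (e 0)) (v (e 3)) = α ∧ segmentLength Λ (v (e 1)) (v (e 2)) = α ∧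
      segmentLength Λ (v (e 1)) (v (e 3)) = β ∧ segmentLength Λ (v (e 0)) (v (e 2)) = β ∧
      segmentLength Λ (v (e 2)) (v (e 3)) = -γ ∧ segmentLength Λ (v (e 0)) (v (e 1)) = -γ ∧
      -- the volume is finite and given by the formula
      volX Λ (geodesicSimplex v) ≠ ⊤ ∧
      (Λ ≠ 0 → (volX Λ (geodesicSimplex v)).toReal =
        1 / (2 * (Λ : ℝ)) *
            (genClausen Λ (2 * α) + genClausen Λ (2 * β) + genClausen Λ (2 * γ)) +
          1 / (Λ : ℝ) *
            (α * Real.log |genSin Λ α| + β * Real.log |genSin Λ β| +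
              γ * Real.log |genSin Λ γ|)) ∧
      (Λ = 0 → (volX Λ (geodesicSimplex v)).toReal = -(α * β * γ) / 3) := by
  -- Positive rescaling to unit representatives changes neither Θ nor its edges; the relabelling `e`
  -- below puts the longest pair of opposite edges at {0,1} and {2,3}.
  set c : Fin 4 → ℝ := fun i => (Real.sqrt (pointForm Λ (v i) (v i)))⁻¹ with hcdef
  have hc : ∀ i, 0 < c i := fun i => inv_pos.2 (Real.sqrt_pos.2 (hv.pointForm_vertex_pos i))
  set w : Fin 4 → R4 := fun i => c i • v i with hw
  have hwv : ∀ i, v i = (c i)⁻¹ • w i := fun i => (inv_smul_smul₀ (hc i).ne' (v i)).symm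
  have htw : IsLightlikeTetrahedron Λ w := hv.smul hc
  have hw1 : ∀ i, pointForm Λ (w i) (w i) = 1 := fun i => by
    have hp := hv.pointForm_vertex_pos i
    simp only [hw, hcdef]
    rw [pointForm_smul_smul, inv_pow, Real.sq_sqrt hp.le, inv_mul_cancel₀ hp.ne']
  have hlen : ∀ i j : Fin 4, i ≠ j →
      segmentLength Λ (v i) (v j) = genDist Λ (w i) (w j) := fun i j hij => by
    rw [hwv i, hwv j]
    exact htw.segmentLength_eq_genDist hw1 (c := fun i => (c i)⁻¹)
      (fun i => inv_pos.2 (hc i)) hij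
  obtain ⟨e, d1, d2, d3, d4⟩ := htw.exists_lengths hw1
  have hne : ∀ i j : Fin 4, i ≠ j → e i ≠ e j := fun i j h => e.injective.ne h
  set α := genDist Λ (w (e 0)) (w (e 3)) with hα
  set β := genDist Λ (w (e 0)) (w (e 2)) with hβ
  have hα0 : 0 < α := (genDist_spec_of_tetrahedron htw hw1 (hne 0 3 (by decide))).1.1
  have hβ0 : 0 < β := (genDist_spec_of_tetrahedron htw hw1 (hne 0 2 (by decide))).1.1
  have hγ : IsGenAngle Λ (α + β) := by
    rw [← d4]
    exact (genDist_spec_of_tetrahedron htw hw1 (hne 0 1 (by decide))).1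
  have hvol : ∀ P, IsAreaFunction Λ P → volX Λ (geodesicSimplex v) =
      ∫⁻ s in Set.Ioo 0 α, ∫⁻ t in Set.Ioo 0 β,
        ENNReal.ofReal (2 * P (s + t) / genSin Λ (s + t) ^ 2) := fun P hP => by
    rw [← geodesicSimplex_smul v hc, ← geodesicSimplex_comp_perm _ e]
    exact (htw.comp_perm e).volX_eq_lintegral_area (fun i => hw1 (e i)) hP rfl d1.symm d2 rfl
      (d3.trans d4) d4
  refine ⟨e, α, β, -(α + β), hα0, hβ0, neg_neg _, hlen _ _ (hne 0 3 (by decide)),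
    (hlen _ _ (hne 1 2 (by decide))).trans d1.symm, (hlen _ _ (hne 1 3 (by decide))).trans d2,
    hlen _ _ (hne 0 2 (by decide)), ?_, ?_, ?_, ?_, ?_⟩
  · rw [neg_neg, hlen _ _ (hne 2 3 (by decide)), d3, d4]
  · rw [neg_neg, hlen _ _ (hne 0 1 (by decide)), d4]
  · rcases eq_or_ne Λ 0 with rfl | h
    · rw [hvol _ isAreaFunction_zero, (lintegral_area_zero hα0 hβ0).2]
      exact ENNReal.ofReal_ne_top
    · rw [hvol _ (isAreaFunction_of_ne_zero h), (lintegral_area_of_ne_zero h hα0 hβ0 hγ).2]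
      exact ENNReal.ofReal_ne_top
  · intro h
    obtain ⟨h0, h2⟩ := lintegral_area_of_ne_zero h hα0 hβ0 hγ
    rw [hvol _ (isAreaFunction_of_ne_zero h), h2, ENNReal.toReal_ofReal h0]
    -- The computation produces a factor Λ where the formula has 1/Λ; they agree for Λ = ±1.
    have hinv : ((Λ : ℝ))⁻¹ = Λ := inv_eq_of_mul_eq_one_left (by
      rw [← sq, sq_cast_of_ne_zero h])
    simp only [edgeVolume, one_div, mul_inv, hinv]
    ring
  · rintro rfl
    obtain ⟨h0, h2⟩ := lintegral_area_zero hα0 hβ0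
    rw [hvol _ isAreaFunction_zero, h2, ENNReal.toReal_ofReal h0]
    ring
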